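/- Let $k$ be a field, $A$ a finite-dimensional (associative, unital) $k$-algebra, $e\in A$ an idempotent, and $AeA$ the two-sided ideal generated by $e$. For a finite-dimensional algebra $B$, let $\operatorname{ind} B$ be the class of finitely generated indecomposable right $B$-modules. A path of length $s\ge 0$ from $M$ to $N$ is a sequence $M=X_0\xrightarrow{f_1}X_1\to\cdots\xrightarrow{f_s}X_s=N$ with all $X_i\in\operatorname{ind}B$ and every $f_i$ a nonzero non-isomorphism. Put $$\mathcal L_B=\{X\in\operatorname{ind}B : \operatorname{pd}_B W\le 1\text{ for every path from some } W\text{ to }X\},$$ $$\mathcal R_B=\{Y\in\operatorname{ind}B : \operatorname{id}_B W\le 1\text{ for every path from }Y\text{ to some }W\}.$$ A subclass of $\operatorname{ind}B$ is cofinite if, up to isomorphism, only finitely many modules in $\operatorname{ind}B$ lie outside it. The algebra $B$ is called - laura if $\mathcal L_B\cup\mathcal R_B$ is cofinite in $\operatorname{ind}B$; - right glued (resp. left glued) if $\mathcal L_B$ (resp. $\mathcal R_B$) is cofinite in $\operatorname{ind}B$; - weakly shod if there is a bound on the lengths of all paths from an indecomposable injective module to an indecomposable projective module; - shod if every $M\in\operatorname{ind}B$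 satisfies $\operatorname{pd}_B M\le 1$ or $\operatorname{id}_B M\le 1$. Then: 1. If $A$ is laura, then so is $A/AeA$. 2. If $A$ is right glued, then so is $A/AeA$; if $A$ is left glued, then so is $A/AeA$. 3. If $A$ is weakly shod, then so is $A/AeA$. 4. If $A$ is shod, then so is $A/AeA$. -/

import Mathlib

open CategoryTheory

universe u

namespace IdempotentQuotient

/-- Right `A`-modules, that is, left modules over the opposite ring. Every finitely generated
right `A`-module is isomorphic to a quotient of some `A ^ n`, hence to one in the universe of `A`. -/
abbrev RightMod (A : Type u) [Ring A] := ModuleCat.{u} Aᵐᵒᵖ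

/-- The finitely generated indecomposable right `A`-modules. -/
def ind (A : Type u) [Ring A] : Set (RightMod A) :=
  {X | Module.Finite Aᵐᵒᵖ X ∧ Indecomposable X}

/-- `IsPath M N s`: there is a path `M = X₀ ⟶ X₁ ⟶ ⋯ ⟶ Xₛ = N` of length `s` in `ind A`, each
arrow being a nonzero non-isomorphism. The trivial path of length `0` is allowed. -/
inductive IsPath {A : Type u} [Ring A] : RightMod A → RightMod A → ℕ → Prop
  | nil {X : RightMod A} (hX : X ∈ ind A) : IsPath X X 0
  | cons {X Y Z : RightMod A} {s : ℕ} (hX : X ∈ ind A) (f : X ⟶ Y) (hf : f ≠ 0)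
      (hf' : ¬ IsIso f) (p : IsPath Y Z s) : IsPath X Z (s + 1)

/-- The left part `𝓛_A`: all predecessors have projective dimension at most one. -/
def leftPart (A : Type u) [Ring A] : Set (RightMod A) :=
  {X | X ∈ ind A ∧ ∀ (W : RightMod A) (s : ℕ), IsPath W X s → HasProjectiveDimensionLE W 1}

/-- The right part `𝓡_A`: all successors have injective dimension at most one. -/
def rightPart (A : Type u) [Ring A] : Set (RightMod A) :=
  {Y | Y ∈ ind A ∧ ∀ (W : RightMod A) (s : ℕ), IsPath Y W s → HasInjectiveDimensionLE W 1}

/-- `S` is cofinite in `ind A`: the modules in `ind A` outside `S` form only finitely many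
isomorphism classes. -/
def CofiniteInInd (A : Type u) [Ring A] (S : Set (RightMod A)) : Prop :=
  Set.Finite ((fun X : RightMod A => Quotient.mk (isIsomorphicSetoid (RightMod A)) X) ''
    (ind A \ S))

/-- `𝓛_A ∪ 𝓡_A` is cofinite in `ind A`. -/
def IsLaura (A : Type u) [Ring A] : Prop :=
  CofiniteInInd A (leftPart A ∪ rightPart A)

/-- `𝓛_A` is cofinite in `ind A`. -/
def IsRightGlued (A : Type u) [Ring A] : Prop :=
  CofiniteInInd A (leftPart A)

/-- `𝓡_A` is cofinite in `ind A`. -/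
def IsLeftGlued (A : Type u) [Ring A] : Prop :=
  CofiniteInInd A (rightPart A)

/-- The lengths of the paths from indecomposable injective to indecomposable projective modules
are bounded. -/
def IsWeaklyShod (A : Type u) [Ring A] : Prop :=
  ∃ l : ℕ, ∀ (I P : RightMod A) (s : ℕ), Injective I → Projective P → IsPath I P s → s ≤ l

/-- Every indecomposable module has projective or injective dimension at most one. -/
def IsShod (A : Type u) [Ring A] : Prop :=
  ∀ M ∈ ind A, HasProjectiveDimensionLE M 1 ∨ HasInjectiveDimensionLE M 1

/-- The quotient `A / AeA` by the two-sided ideal generated by `e`. -/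
abbrev quotByIdeal {A : Type u} [Ring A] (e : A) : Type u :=
  (TwoSidedIdeal.span {e}).ringCon.Quotient

end IdempotentQuotient

/-!
Restriction of scalars along a surjection `A → B` whose kernel is an idempotent ideal, such as
`A → A / AeA`, is exact and fully faithful, and its essential image is closed under extensions.
Hence it is bijective on `Ext¹` and injective on `Ext²`, so that a `B`-module has projective or
injective dimension at most one as soon as it does over `A`. Since a path over `B` is also a path
over `A`, the `B`-modules in `𝓛_A` lie in `𝓛_B`, and likewise for the right parts.

For weakly shod algebras one needs in addition that a path over `B` from an injective module cannot
stay in `𝓛_B` for long. A module in `𝓛_B` with a nonzero map from an injective one is Ext-injective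
in `𝓛_B`, and nonzero maps between such modules compose to nonzero maps; so the Euler forms of the
modules on the path are linearly independent, and their number is at most the rank of the
Grothendieck group. Dually for paths in `𝓡_B` to a projective module. The middle part of a path
from an injective to a projective `B`-module therefore leads from outside `𝓛_B` to outside `𝓡_B`,
and over `A` it extends to a path from an injective to a projective module, whose length is bounded.
-/

namespace IdempotentQuotient

open Limits Relation
open Abelian (Ext)

section Indecomposable

variable {C : Type*} [Category C] [Abelian C] {X Y Z : C}

lemma id_ne_zero_of_indecomposable (hX : Indecomposable X) : 𝟙 X ≠ 0 := fun h =>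
  hX.1 ((IsZero.iff_id_eq_zero X).2 h)

lemma exists_iso_biprod_of_idempotent {p : X ⟶ X} (hp : p ≫ p = p) :
    ∃ Y Z : C, Nonempty (X ≅ Y ⊞ Z) ∧ (IsZero Y → p = 0) ∧ (IsZero Z → p = 𝟙 X) := by
  have hq : (𝟙 X - p) ≫ (𝟙 X - p) = 𝟙 X - p := by simp [hp]
  obtain ⟨Y, i, r, hir, hri⟩ := IsIdempotentComplete.idempotents_split X p hp
  obtain ⟨Z, j, s, hjs, hsj⟩ := IsIdempotentComplete.idempotents_split X (𝟙 X - p) hq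
  have : IsSplitMono i := ⟨⟨r, hir⟩⟩
  have : IsSplitMono j := ⟨⟨s, hjs⟩⟩
  have his : i ≫ s = 0 := by
    rw [← cancel_mono j, Category.assoc, hsj, ← hri]
    simp [reassoc_of% hir]
  have hjr : j ≫ r = 0 := by
    rw [← cancel_mono i, Category.assoc, hri, ← sub_sub_cancel (𝟙 X) p, ← hsj]
    simp [reassoc_of% hjs]
  refine ⟨Y, Z, ⟨⟨biprod.lift r s, biprod.desc i j, ?_, ?_⟩⟩, fun hY => ?_, fun hZ => ?_⟩
  · simp [biprod.lift_desc, hri, hsj]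
  · ext <;> simp [hir, hjs, his, hjr]
  · rw [← hri, hY.eq_of_src i 0, comp_zero]
  · rw [eq_comm, ← sub_eq_zero, ← hsj, hZ.eq_of_src j 0, comp_zero]

lemma indecomposable_iff_idempotent :
    Indecomposable X ↔ ¬ IsZero X ∧ ∀ p : X ⟶ X, p ≫ p = p → p = 0 ∨ p = 𝟙 X := by
  refine ⟨fun h => ⟨h.1, fun p hp => ?_⟩, fun h => ⟨h.1, fun Y Z e => ?_⟩⟩
  · obtain ⟨Y, Z, ⟨e⟩, hY, hZ⟩ := exists_iso_biprod_of_idempotent hp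
    exact (h.2 Y Z e).imp hY hZ
  · simp only [IsZero.iff_id_eq_zero]
    refine (h.2 (e.hom ≫ biprod.fst ≫ biprod.inl ≫ e.inv) (by simp)).imp (fun h0 => ?_)
      fun h1 => ?_
    · simpa using ((biprod.inl ≫ e.inv) ≫= h0) =≫ (e.hom ≫ biprod.fst)
    · simpa using (((biprod.inr ≫ e.inv) ≫= h1) =≫ (e.hom ≫ biprod.snd)).symm

lemma indecomposable_op_iff : Indecomposable (Opposite.op X) ↔ Indecomposable X := by
  rw [indecomposable_iff_idempotent, indecomposable_iff_idempotent]
  refine and_congr (not_congr ⟨IsZero.unop, IsZero.op⟩) ⟨fun h p hp => ?_, fun h p hp => ?_⟩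
  · exact (h p.op (congrArg Quiver.Hom.op hp)).imp (congrArg Quiver.Hom.unop)
      (congrArg Quiver.Hom.unop)
  · exact (h p.unop (congrArg Quiver.Hom.unop hp)).imp (congrArg Quiver.Hom.op)
      (congrArg Quiver.Hom.op)

lemma isZero_map_iff {D : Type*} [Category D] [Abelian D] (F : C ⥤ D) [F.Faithful]
    [F.PreservesZeroMorphisms] : IsZero (F.obj X) ↔ IsZero X := by
  rw [IsZero.iff_id_eq_zero, IsZero.iff_id_eq_zero, ← F.map_id, F.map_eq_zero_iff]

lemma indecomposable_map_iff {D : Type*} [Category D] [Abelian D] (F : C ⥤ D) [F.Full]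
    [F.Faithful] [F.PreservesZeroMorphisms] : Indecomposable (F.obj X) ↔ Indecomposable X := by
  rw [indecomposable_iff_idempotent, indecomposable_iff_idempotent]
  refine and_congr (not_congr (isZero_map_iff F)) ⟨fun h p hp => ?_, fun h p hp => ?_⟩
  · have := h (F.map p) (by rw [← F.map_comp, hp])
    rwa [F.map_eq_zero_iff, ← F.map_id, F.map_injective.eq_iff] at this
  · obtain ⟨p, rfl⟩ := F.map_surjective p
    rw [F.map_eq_zero_iff, ← F.map_id, F.map_injective.eq_iff]
    exact h p (F.map_injective (by rw [F.map_comp, hp]))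

lemma isIso_of_retract_of_indecomposable (h : Retract X Y) (hX : ¬ IsZero X)
    (hY : Indecomposable Y) : IsIso h.i ∧ IsIso h.r := by
  obtain h0 | h1 := (indecomposable_iff_idempotent.1 hY).2 (h.r ≫ h.i) (by simp)
  · refine absurd ((IsZero.iff_id_eq_zero X).2 ?_) hX
    simpa using (h.i ≫= h0) =≫ h.r
  · exact ⟨⟨h.r, h.retract, h1⟩, ⟨h.i, h1, h.retract⟩⟩

end Indecomposable

/-- Every object has finite length: there is an `ℕ`-valued function, additive on short exact
sequences, that vanishes on zero objects only. -/
class HasFiniteLength (C : Type*) [Category C] [Abelian C] : Prop where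
  exists_length : ∃ ℓ : C → ℕ,
    (∀ S : ShortComplex C, S.ShortExact → ℓ S.X₂ = ℓ S.X₁ + ℓ S.X₃) ∧ ∀ X, ℓ X = 0 → IsZero X

section ShortExact

variable {C : Type*} [Category C] [Abelian C] {X Y : C}

lemma shortExact_kernel (f : X ⟶ Y) [Epi f] :
    (ShortComplex.mk (kernel.ι f) f (kernel.condition f)).ShortExact :=
  .mk' (ShortComplex.kernelSequence_exact f) (inferInstanceAs (Mono (kernel.ι f))) ‹_›

lemma shortExact_cokernel (f : X ⟶ Y) [Mono f] :
    (ShortComplex.mk f (cokernel.π f) (cokernel.condition f)).ShortExact :=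
  .mk' (ShortComplex.cokernelSequence_exact f) ‹_› (inferInstanceAs (Epi (cokernel.π f)))

end ShortExact

section Length

variable {C : Type*} [Category C] [Abelian C] [HasFiniteLength C] {X Y : C}

/-- An additive size function on the objects, used as the induction parameter. -/
noncomputable def length (X : C) : ℕ := (HasFiniteLength.exists_length (C := C)).choose X

lemma length_eq_add {S : ShortComplex C} (hS : S.ShortExact) :
    length S.X₂ = length S.X₁ + length S.X₃ :=
  (HasFiniteLength.exists_length (C := C)).choose_spec.1 S hS

lemma isZero_of_length_eq_zero (h : length X = 0) : IsZero X :=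
  (HasFiniteLength.exists_length (C := C)).choose_spec.2 X h

instance : HasFiniteLength Cᵒᵖ where
  exists_length := ⟨fun X => length X.unop,
    fun _ hS => (length_eq_add hS.unop).trans (add_comm _ _),
    fun _ h => (isZero_of_length_eq_zero h).op⟩

lemma length_lt_of_mono (f : X ⟶ Y) [Mono f] (hf : ¬ IsIso f) : length X < length Y := by
  have h := shortExact_cokernel f
  have hadd : length Y = length X + length (cokernel f) := length_eq_add h
  have : length (cokernel f) ≠ 0 := fun h0 => hf (h.isIso_f_iff.2 (isZero_of_length_eq_zero h0))
  lia

lemma exists_indecomposable_retract {A : Type*} [AddCommMonoid A] {φ : (X ⟶ X) →+ A}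
    (hφ : φ (𝟙 X) ≠ 0) :
    ∃ (Z : C) (ρ : Retract Z X), Indecomposable Z ∧ φ (ρ.r ≫ ρ.i) ≠ 0 := by
  induction hn : length X using Nat.strong_induction_on generalizing X with
  | _ n ih =>
  by_cases hX : Indecomposable X
  · exact ⟨X, .refl X, hX, by simpa using hφ⟩
  have of_retract {W : C} (ρ : Retract W X) (hlt : length W < length X)
      (hρ : φ (ρ.r ≫ ρ.i) ≠ 0) :
      ∃ (Z : C) (ρ : Retract Z X), Indecomposable Z ∧ φ (ρ.r ≫ ρ.i) ≠ 0 := by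
    obtain ⟨Z, σ, hZ, hσ⟩ := ih _ (hn ▸ hlt)
      (φ := φ.comp ((Preadditive.leftComp _ ρ.r).comp (Preadditive.rightComp _ ρ.i)))
      (by simpa [Preadditive.leftComp, Preadditive.rightComp] using hρ) rfl
    exact ⟨Z, σ.trans ρ, hZ, by simpa [Preadditive.leftComp, Preadditive.rightComp] using hσ⟩
  obtain ⟨Y, Z, e, hY, hZ⟩ : ∃ (Y Z : C) (_ : X ≅ Y ⊞ Z), ¬ IsZero Y ∧ ¬ IsZero Z := by
    have h0 : ¬ IsZero X := fun h0 => hφ (by rw [h0.eq_of_src (𝟙 X) 0, map_zero])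
    simpa [Indecomposable, h0] using hX
  have hlen : length X = length Y + length Z := by
    refine length_eq_add (S := .mk (biprod.inl ≫ e.inv) (e.hom ≫ biprod.snd) (by simp)) ?_
    exact ShortComplex.shortExact_of_iso
      (S₁ := .mk biprod.inl biprod.snd biprod.inl_snd)
      (ShortComplex.isoMk (Iso.refl _) e.symm (Iso.refl _))
      (ShortComplex.Splitting.ofHasBinaryBiproduct Y Z).shortExact
  have hY' := mt isZero_of_length_eq_zero hY
  have hZ' := mt isZero_of_length_eq_zero hZ
  let ρ : Retract Y X := ⟨biprod.inl ≫ e.inv, e.hom ≫ biprod.fst, by simp⟩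
  let σ : Retract Z X := ⟨biprod.inr ≫ e.inv, e.hom ≫ biprod.snd, by simp⟩
  have hsum : φ (ρ.r ≫ ρ.i) + φ (σ.r ≫ σ.i) ≠ 0 := by
    have : ρ.r ≫ ρ.i + σ.r ≫ σ.i = 𝟙 X := calc
      _ = e.hom ≫ (biprod.fst ≫ biprod.inl + biprod.snd ≫ biprod.inr) ≫ e.inv := by
        simp [ρ, σ, -biprod.total]
      _ = 𝟙 X := by simp only [biprod.total, Category.id_comp, Iso.hom_inv_id]
    rwa [← map_add, this]
  by_cases h1 : φ (ρ.r ≫ ρ.i) = 0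
  · exact of_retract σ (by lia) (by simpa [h1] using hsum)
  · exact of_retract ρ (by lia) h1

lemma exists_indecomposable_retract_comp_ne_zero {f : Y ⟶ X} (hf : f ≠ 0) :
    ∃ (Z : C) (ρ : Retract Z X), Indecomposable Z ∧ f ≫ ρ.r ≠ 0 := by
  obtain ⟨Z, ρ, hZ, hρ⟩ := exists_indecomposable_retract (φ := Preadditive.leftComp X f)
    (by simpa [Preadditive.leftComp] using hf)
  exact ⟨Z, ρ, hZ, fun h0 => hρ (by simp [Preadditive.leftComp, reassoc_of% h0])⟩

lemma exists_indecomposable_retract_ne_zero_comp {f : X ⟶ Y} (hf : f ≠ 0) :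
    ∃ (Z : C) (ρ : Retract Z X), Indecomposable Z ∧ ρ.i ≫ f ≠ 0 := by
  obtain ⟨Z, ρ, hZ, hρ⟩ := exists_indecomposable_retract (φ := Preadditive.rightComp X f)
    (by simpa [Preadditive.rightComp] using hf)
  exact ⟨Z, ρ, hZ, fun h0 => hρ (by simp [Preadditive.rightComp, h0])⟩

end Length

section Precedes

variable {C : Type*} [Category C] [Abelian C]

/-- One arrow of a path: a nonzero non-isomorphism between indecomposable objects. -/
def Precedes (X Y : C) : Prop :=
  Indecomposable X ∧ Indecomposable Y ∧ ∃ f : X ⟶ Y, f ≠ 0 ∧ ¬ IsIso f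

lemma precedes_map_iff {D : Type*} [Category D] [Abelian D] (F : C ⥤ D) [F.Full] [F.Faithful]
    [F.PreservesZeroMorphisms] {X Y : C} : Precedes (F.obj X) (F.obj Y) ↔ Precedes X Y := by
  simp only [Precedes, indecomposable_map_iff, F.map_surjective.exists,
    ne_eq, F.map_eq_zero_iff, isIso_iff_of_reflects_iso]

lemma indecomposable_iff_of_reflTransGen {X Y : C} (h : ReflTransGen Precedes X Y) :
    Indecomposable X ↔ Indecomposable Y := by
  induction h with
  | refl => rfl
  | tail _ h ih => exact ih.trans (iff_of_true h.1 h.2.1)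

end Precedes

section Ext

universe w

variable {C : Type*} [Category C] [Abelian C] [HasExt.{w} C] {X Y Z : C}

lemma exists_shortExact_extClass_eq_comp {S : ShortComplex C} (hS : S.ShortExact)
    (g : S.X₁ ⟶ Y) :
    ∃ (E : C) (i : Y ⟶ E) (p : E ⟶ S.X₃) (hip : i ≫ p = 0)
      (hS' : (ShortComplex.mk i p hip).ShortExact),
        hS'.extClass = hS.extClass.comp (Ext.mk₀ g) (add_zero 1) := by
  have := hS.mono_f
  have := hS.epi_g
  have hp : S.f ≫ S.g = g ≫ (0 : Y ⟶ S.X₃) := by simp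
  let p : pushout S.f g ⟶ S.X₃ := pushout.desc S.g 0 hp
  have hlp : pushout.inl S.f g ≫ p = S.g := pushout.inl_desc _ _ _
  have hrp : pushout.inr S.f g ≫ p = 0 := pushout.inr_desc _ _ _
  have : Epi p := epi_of_epi_fac hlp
  have hS' : (ShortComplex.mk (pushout.inr S.f g) p hrp).ShortExact := by
    refine .mk' (ShortComplex.exact_of_g_is_cokernel _ ?_)
      (inferInstanceAs (Mono (pushout.inr S.f g))) ‹_›
    refine CokernelCofork.IsColimit.ofπ' _ _ fun {T} (x : pushout S.f g ⟶ T)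
      (hx : pushout.inr S.f g ≫ x = 0) => ?_
    have hd : S.f ≫ pushout.inl S.f g ≫ x = 0 := by
      rw [pushout.condition_assoc, hx, comp_zero]
    refine ⟨hS.exact.desc _ hd, pushout.hom_ext ?_ ?_⟩
    · rw [reassoc_of% hlp]
      exact hS.exact.g_desc _ hd
    · rw [reassoc_of% hrp, hx, zero_comp]
  refine ⟨_, _, p, hrp, hS', ?_⟩
  have := hS.extClass_naturality hS'
    ⟨g, pushout.inl S.f g, 𝟙 _, pushout.condition.symm, by simpa using hlp⟩
  simpa using this.symm

lemma exists_shortExact_extClass_eq [EnoughProjectives C] (x : Ext X Y 1) :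
    ∃ (E : C) (i : Y ⟶ E) (p : E ⟶ X) (hip : i ≫ p = 0)
      (hS : (ShortComplex.mk i p hip).ShortExact), hS.extClass = x := by
  have hQ := shortExact_kernel (Projective.π X)
  obtain ⟨g, rfl⟩ := Ext.contravariant_sequence_exact₃ hQ Y x
    (Ext.eq_zero_of_projective (P := Projective.over X) _) (n₀ := 0) rfl
  obtain ⟨g, rfl⟩ := Ext.homEquiv₀.symm.surjective g
  exact exists_shortExact_extClass_eq_comp hQ g

lemma extClass_eq_zero_iff {S : ShortComplex C} (hS : S.ShortExact) :
    hS.extClass = 0 ↔ ∃ r, S.f ≫ r = 𝟙 S.X₁ := by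
  refine ⟨fun h => ?_, fun ⟨r, hr⟩ => ?_⟩
  · obtain ⟨r, hr⟩ := Ext.contravariant_sequence_exact₁ hS S.X₁ (Ext.mk₀ (𝟙 S.X₁)) (add_zero 1)
      (by rw [h, Ext.zero_comp])
    obtain ⟨r, rfl⟩ := Ext.homEquiv₀.symm.surjective r
    exact ⟨r, (Ext.mk₀_bijective _ _).injective (by rw [← Ext.mk₀_comp_mk₀]; exact hr)⟩
  · rw [← Ext.comp_mk₀_id hS.extClass, ← hr, ← Ext.mk₀_comp_mk₀, hS.extClass_comp_assoc]

variable [HasFiniteLength C]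

lemma exists_indecomposable_retract_comp_mk₀_ne_zero {n : ℕ} {x : Ext Y X n} (hx : x ≠ 0) :
    ∃ (Z : C) (ρ : Retract Z X), Indecomposable Z ∧
      x.comp (Ext.mk₀ ρ.r) (add_zero n) ≠ 0 := by
  obtain ⟨Z, ρ, hZ, hρ⟩ := exists_indecomposable_retract (X := X)
    (φ := AddMonoidHom.mk' (fun f => x.comp (Ext.mk₀ f) (add_zero n)) (by simp [Ext.mk₀_add]))
    (by simpa using hx)
  refine ⟨Z, ρ, hZ, fun h0 => hρ ?_⟩
  rw [AddMonoidHom.mk'_apply, ← Ext.mk₀_comp_mk₀,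
    ← Ext.comp_assoc_of_second_deg_zero, h0, Ext.zero_comp]

/-- The middle term of a nonsplit extension has an indecomposable summand on which both maps are
nonzero non-isomorphisms. -/
lemma exists_precedes_of_ext_ne_zero [EnoughProjectives C] (hX : Indecomposable X)
    (hY : Indecomposable Y) {x : Ext X Y 1} (hx : x ≠ 0) :
    ∃ E : C, Precedes Y E ∧ Precedes E X := by
  obtain ⟨E, i, p, hip, hS, rfl⟩ := exists_shortExact_extClass_eq x
  have := hS.mono_f
  have := hS.epi_g
  have hi (r : E ⟶ Y) : i ≫ r ≠ 𝟙 Y := fun hr => hx ((extClass_eq_zero_iff hS).2 ⟨r, hr⟩)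
  have hp (s : X ⟶ E) : s ≫ p ≠ 𝟙 X := fun hs => hx <| by
    rw [← Ext.mk₀_id_comp hS.extClass, ← hs, ← Ext.mk₀_comp_mk₀,
      Ext.comp_assoc_of_second_deg_zero, hS.comp_extClass, Ext.comp_zero]
  have hi0 : i ≠ 0 := fun h0 =>
    id_ne_zero_of_indecomposable hY (by rw [← cancel_mono i]; simp [h0])
  obtain ⟨E', ρ, hE', hne⟩ := exists_indecomposable_retract_comp_ne_zero hi0
  have hiso : ¬ IsIso (i ≫ ρ.r) := fun _ => hi (ρ.r ≫ inv (i ≫ ρ.r)) (by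
    rw [← Category.assoc, IsIso.hom_inv_id])
  refine ⟨E', ⟨hY, hE', _, hne, hiso⟩, hE', hX, ρ.i ≫ p, fun h0 => hiso ?_, fun _ => ?_⟩
  · have hl : hS.exact.lift ρ.i h0 ≫ i = ρ.i := hS.exact.lift_f _ _
    exact (isIso_of_retract_of_indecomposable ⟨hS.exact.lift ρ.i h0, i ≫ ρ.r, by
      rw [reassoc_of% hl, ρ.retract]⟩ hE'.1 hY).2
  · exact hp (inv (ρ.i ≫ p) ≫ ρ.i) (by rw [Category.assoc, IsIso.inv_hom_id])

end Ext

section LeftPart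

universe w

variable {C : Type*} [Category C] [Abelian C]

lemma subsingleton_ext_one_of_epi [HasExt.{w} C] {F J Z : C} [HasProjectiveDimensionLE F 1]
    [Injective J] (e : J ⟶ Z) [Epi e] : Subsingleton (Ext F Z 1) := by
  refine subsingleton_of_forall_eq 0 fun x => ?_
  obtain ⟨y, rfl⟩ := Ext.covariant_sequence_exact₃ F (shortExact_kernel e) x (n₁ := 2) rfl
    (Ext.eq_zero_of_hasProjectiveDimensionLT _ 2 le_rfl)
  rw [Ext.eq_zero_of_injective (I := J) y, Ext.zero_comp]

lemma exists_f_comp_eq_of_subsingleton_ext [HasExt.{w} C] {S : ShortComplex C}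
    (hS : S.ShortExact) {Y : C} [Subsingleton (Ext S.X₃ Y 1)] (g : S.X₁ ⟶ Y) :
    ∃ h : S.X₂ ⟶ Y, S.f ≫ h = g := by
  obtain ⟨h, hh⟩ := Ext.contravariant_sequence_exact₁ hS Y (Ext.mk₀ g) (add_zero 1)
    (Subsingleton.elim _ _)
  obtain ⟨h, rfl⟩ := (Ext.mk₀_bijective _ _).surjective h
  exact ⟨h, (Ext.mk₀_bijective _ _).injective (by rw [← Ext.mk₀_comp_mk₀, hh])⟩

/-- The left part: the indecomposable objects all of whose predecessors have projective dimension
at most one. -/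
def IsLeft (X : C) : Prop :=
  Indecomposable X ∧ ∀ W, ReflTransGen Precedes W X → HasProjectiveDimensionLE W 1

/-- The right part: the indecomposable objects all of whose successors have injective dimension
at most one. -/
def IsRight (X : C) : Prop :=
  Indecomposable X ∧ ∀ W, ReflTransGen Precedes X W → HasInjectiveDimensionLE W 1

/-- There is a nonzero morphism to `X` from an injective object. -/
def ReceivesInjective (X : C) : Prop := ∃ (J : C) (_ : Injective J) (u : J ⟶ X), u ≠ 0

lemma IsLeft.hasProjectiveDimensionLE {X : C} (hX : IsLeft X) : HasProjectiveDimensionLE X 1 :=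
  hX.2 X .refl

lemma IsLeft.of_precedes {X Y : C} (hY : IsLeft Y) (h : Precedes X Y) : IsLeft X :=
  ⟨h.1, fun W hW => hY.2 W (hW.tail h)⟩

lemma IsLeft.of_iso {X Y : C} (hY : IsLeft Y) (e : X ≅ Y) (hX : Indecomposable X) :
    IsLeft X := by
  refine ⟨hX, fun W hW => ?_⟩
  obtain rfl | ⟨Z, hWZ, hZ, -, g, hg, hg'⟩ := hW.cases_tail
  · have := hY.hasProjectiveDimensionLE
    exact hasProjectiveDimensionLT_of_iso e.symm 2
  · refine hY.2 W (hWZ.tail ⟨hZ, hY.1, g ≫ e.hom, fun h0 => hg ?_, fun h => hg' ?_⟩)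
    · rwa [← cancel_mono e.hom, zero_comp]
    · exact IsIso.of_isIso_comp_right g e.hom

lemma IsLeft.of_hom {X Y : C} (hY : IsLeft Y) (hX : Indecomposable X) {f : X ⟶ Y}
    (hf : f ≠ 0) : IsLeft X := by
  by_cases hiso : IsIso f
  · exact hY.of_iso (asIso f) hX
  · exact hY.of_precedes ⟨hX, hY.1, f, hf, hiso⟩

variable [HasFiniteLength C]

/-- If `u` factored through the kernel of `d`, then some summand `N` of the kernel would receive a
nonzero morphism from `J`; the projection onto `N` would extend to `Y`, against
indecomposability. -/
lemma IsLeft.comp_ne_zero_of_epi [HasExt.{w} C] {J Y Z : C} (hY : IsLeft Y) (hZ : IsLeft Z)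
    (H : ∀ N : C, IsLeft N → ReceivesInjective N → length N < length Y →
      Subsingleton (Ext Z N 1))
    (hJ : Injective J) {u : J ⟶ Y} (hu : u ≠ 0) (d : Y ⟶ Z) [Epi d] : u ≫ d ≠ 0 := by
  intro hud
  have hv : kernel.lift d u hud ≠ 0 := fun h0 => hu (by
    rw [← kernel.lift_ι d u hud, h0, zero_comp])
  obtain ⟨N, ρ, hN, hρ⟩ := exists_indecomposable_retract_comp_ne_zero hv
  have : Mono (ρ.i ≫ kernel.ι d) := mono_comp _ _
  have hNY : ¬ IsIso (ρ.i ≫ kernel.ι d) := fun _ => hZ.1.1 ((IsZero.iff_id_eq_zero Z).2 (by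
    rw [← cancel_epi d, ← cancel_epi (ρ.i ≫ kernel.ι d)]
    simp))
  have hNL : IsLeft N := hY.of_hom hN (f := ρ.i ≫ kernel.ι d) fun h0 =>
    id_ne_zero_of_indecomposable hN (by
      rw [← cancel_mono (ρ.i ≫ kernel.ι d), h0, comp_zero, comp_zero])
  have := H N hNL ⟨J, hJ, _, hρ⟩ (length_lt_of_mono _ hNY)
  obtain ⟨h, hh⟩ := exists_f_comp_eq_of_subsingleton_ext (shortExact_kernel d) ρ.r
  have hret : (ρ.i ≫ kernel.ι d) ≫ h = 𝟙 N := by rw [Category.assoc, hh, ρ.retract]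
  exact hNY (isIso_of_retract_of_indecomposable ⟨_, h, hret⟩ hN.1 hY.1).1

variable [EnoughProjectives C]

/-- A nonzero class in `Ext F Y 1` stays nonzero on a summand `Z` of the cokernel of `u : J ⟶ Y`,
as the image of `u` is a quotient of an injective. Then `Z` precedes `F`, hence is in the left part,
but `u` dies in `Z`, against the preceding lemma. -/
lemma IsLeft.subsingleton_ext_one [HasExt.{w} C] {F Y : C} (hF : IsLeft F) (hY : IsLeft Y)
    (hY' : ReceivesInjective Y) : Subsingleton (Ext F Y 1) := by
  induction hn : length Y using Nat.strong_induction_on generalizing F Y with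
  | _ n ih =>
  refine subsingleton_of_forall_eq 0 ?_
  by_contra! ⟨x, hx⟩
  obtain ⟨J, hJ, u, hu⟩ := hY'
  set π := cokernel.π (image.ι u)
  have hπ : x.comp (Ext.mk₀ π) (add_zero 1) ≠ 0 := fun h0 => by
    obtain ⟨y, rfl⟩ := Ext.covariant_sequence_exact₂ F (shortExact_cokernel (image.ι u)) x h0
    have := hF.hasProjectiveDimensionLE
    have := subsingleton_ext_one_of_epi (F := F) (factorThruImage u)
    rw [Subsingleton.elim y 0, Ext.zero_comp] at hx
    exact hx rfl
  obtain ⟨Z, ρ, hZ, hρ⟩ := exists_indecomposable_retract_comp_mk₀_ne_zero hπ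
  obtain ⟨E, hZE, hEF⟩ := exists_precedes_of_ext_ne_zero hF.1 hZ hρ
  have hZL : IsLeft Z := (hF.of_precedes hEF).of_precedes hZE
  have : Epi (π ≫ ρ.r) := epi_comp _ _
  refine hY.comp_ne_zero_of_epi hZL
    (fun N hN hN' hlt => ih _ (hn ▸ hlt) hZL hN hN' rfl) hJ hu (π ≫ ρ.r) ?_
  nth_rw 1 [← image.fac u]
  rw [Category.assoc, cokernel.condition_assoc, zero_comp, comp_zero]

lemma IsLeft.comp_ne_zero {J Y F : C} (hY : IsLeft Y) (hF : IsLeft F) (hJ : Injective J)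
    {u : J ⟶ Y} (hu : u ≠ 0) {f : Y ⟶ F} (hf : f ≠ 0) : u ≫ f ≠ 0 := by
  let := HasExt.standard C
  intro huf
  obtain ⟨Z, ρ, hZ, -⟩ := exists_indecomposable_retract_comp_ne_zero
    (f := factorThruImage f) fun h0 => hf (by rw [← image.fac f, h0, zero_comp])
  have : Mono (ρ.i ≫ image.ι f) := mono_comp _ _
  have : Epi (factorThruImage f ≫ ρ.r) := epi_comp _ _
  have hZL : IsLeft Z := hF.of_hom hZ (f := ρ.i ≫ image.ι f) fun h0 =>
    id_ne_zero_of_indecomposable hZ (by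
      rw [← cancel_mono (ρ.i ≫ image.ι f), h0, comp_zero, comp_zero])
  have hu0 : u ≫ factorThruImage f = 0 := by
    rw [← cancel_mono (image.ι f), Category.assoc, image.fac, huf, zero_comp]
  refine hY.comp_ne_zero_of_epi hZL (fun N hN hN' _ => hZL.subsingleton_ext_one hN hN') hJ hu
    (factorThruImage f ≫ ρ.r) ?_
  rw [reassoc_of% hu0, zero_comp]

lemma IsLeft.receivesInjective_of_hom {Y F : C} (hY : IsLeft Y) (hY' : ReceivesInjective Y)
    (hF : IsLeft F) {f : Y ⟶ F} (hf : f ≠ 0) : ReceivesInjective F := by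
  obtain ⟨J, hJ, u, hu⟩ := hY'
  exact ⟨J, hJ, u ≫ f, hY.comp_ne_zero hF hJ hu hf⟩

lemma IsLeft.comp_ne_zero_of_receivesInjective {X Y F : C} (hX : IsLeft X)
    (hX' : ReceivesInjective X) (hY : IsLeft Y) (hF : IsLeft F) {f : X ⟶ Y} (hf : f ≠ 0)
    {g : Y ⟶ F} (hg : g ≠ 0) : f ≫ g ≠ 0 := by
  obtain ⟨J, hJ, u, hu⟩ := hX'
  have := hY.comp_ne_zero hF hJ (hX.comp_ne_zero hY hJ hu hf) hg
  exact fun h0 => this (by rw [Category.assoc, h0, comp_zero])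

lemma exists_injective_reflTransGen_precedes [EnoughInjectives C] {X : C}
    (hX : Indecomposable X) (h : ¬ HasProjectiveDimensionLE X 1) :
    ∃ J, Indecomposable J ∧ Injective J ∧ ReflTransGen Precedes J X := by
  let := HasExt.standard C
  obtain ⟨Y, x, hx⟩ : ∃ (Y : C) (x : Ext X Y 2), x ≠ 0 := by
    contrapose! h
    exact hasProjectiveDimensionLT_of_enoughInjectives X 2
      fun Y => subsingleton_of_forall_eq 0 (h Y)
  obtain ⟨y, rfl⟩ := Ext.covariant_sequence_exact₁ X (shortExact_cokernel (Injective.ι Y)) x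
    (Ext.eq_zero_of_injective (I := Injective.under Y) _) (n₀ := 1) rfl
  obtain ⟨Z, ρ, hZ, hρ⟩ := exists_indecomposable_retract_comp_mk₀_ne_zero (x := y)
    fun h0 => hx (by rw [h0, Ext.zero_comp])
  obtain ⟨E, hZE, hEX⟩ := exists_precedes_of_ext_ne_zero hX hZ hρ
  have hZX : ReflTransGen Precedes Z X := (ReflTransGen.single hZE).tail hEX
  obtain ⟨J, σ, hJ, hσ⟩ := exists_indecomposable_retract_ne_zero_comp
    (f := cokernel.π (Injective.ι Y) ≫ ρ.r) fun h0 => id_ne_zero_of_indecomposable hZ (by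
      rw [← cancel_epi (cokernel.π (Injective.ι Y) ≫ ρ.r), h0, zero_comp, zero_comp])
  have hJ' : Injective J := σ.injective
  by_cases hiso : IsIso (σ.i ≫ cokernel.π (Injective.ι Y) ≫ ρ.r)
  · exact ⟨Z, hZ, Injective.of_iso (asIso (σ.i ≫ cokernel.π (Injective.ι Y) ≫ ρ.r)) hJ', hZX⟩
  · exact ⟨J, hJ, hJ', hZX.head ⟨hJ, hZ, _, hσ, hiso⟩⟩

end LeftPart

section AdditiveFunctions

variable (C : Type*) [Category C] [Abelian C]

/-- The rational-valued functions on objects that are additive on short exact sequences, that is,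
the `ℚ`-linear dual of the Grothendieck group of `C`. -/
def additiveFunctions : Submodule ℚ (C → ℚ) where
  carrier := {χ | ∀ S : ShortComplex C, S.ShortExact → χ S.X₂ = χ S.X₁ + χ S.X₃}
  zero_mem' := by simp
  add_mem' h h' S hS := by simp only [Pi.add_apply, h S hS, h' S hS, add_add_add_comm]
  smul_mem' c _ h S hS := by simp only [Pi.smul_apply, h S hS, smul_add]

variable {C}

lemma apply_eq_zero_of_mem_additiveFunctions {χ : C → ℚ} (hχ : χ ∈ additiveFunctions C) {X : C}
    (hX : IsZero X) : χ X = 0 := by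
  have : χ X = χ X + χ X := hχ (.mk (𝟙 X) (0 : X ⟶ X) comp_zero)
    (.mk' ((ShortComplex.exact_iff_epi _ rfl).2 inferInstance) inferInstance
      ⟨fun _ _ _ => hX.eq_of_src _ _⟩)
  linarith

lemma apply_eq_of_mem_additiveFunctions {χ : C → ℚ} (hχ : χ ∈ additiveFunctions C) {X Y : C}
    (e : X ≅ Y) : χ X = χ Y := by
  have h : χ Y = χ X + χ (cokernel e.hom) := hχ _ (shortExact_cokernel e.hom)
  rw [h, apply_eq_zero_of_mem_additiveFunctions hχ (isZero_cokernel_of_epi e.hom), add_zero]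

instance [FiniteDimensional ℚ (additiveFunctions C)] :
    FiniteDimensional ℚ (additiveFunctions Cᵒᵖ) :=
  .of_injective (LinearMap.restrict (LinearMap.funLeft ℚ ℚ (Opposite.op (α := C)))
    (q := additiveFunctions C) fun χ (hχ : χ ∈ additiveFunctions Cᵒᵖ) S hS =>
      (hχ S.op hS.op).trans (add_comm _ _))
    fun _ _ h => Subtype.ext <| funext fun X => congrFun (congrArg Subtype.val h) X.unop

end AdditiveFunctions

section Linear

variable {k : Type*} [Field k] {C : Type*} [Category C] [Preadditive C] [Linear k C]

instance : Linear k Cᵒᵖ where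
  homModule X Y := Equiv.module k (opEquiv X Y)
  smul_comp _ _ _ r f g := Quiver.Hom.unop_inj (Linear.comp_smul _ _ _ g.unop r f.unop)
  comp_smul _ _ _ f r g := Quiver.Hom.unop_inj (Linear.smul_comp _ _ _ r g.unop f.unop)

instance [∀ X Y : C, Module.Finite k (X ⟶ Y)] (X Y : Cᵒᵖ) : Module.Finite k (X ⟶ Y) :=
  .equiv (Equiv.linearEquiv k (opEquiv X Y)).symm

end Linear

section FiniteHom

lemma finrank_eq_add_of_exact {k U V W : Type*} [Field k] [AddCommGroup U] [AddCommGroup V]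
    [AddCommGroup W] [Module k U] [Module k V] [Module k W] [Module.Finite k V] {f : U →ₗ[k] V}
    {g : V →ₗ[k] W} (hf : Function.Injective f) (hfg : Function.Exact f g)
    (hg : Function.Surjective g) :
    Module.finrank k V = Module.finrank k U + Module.finrank k W := by
  rw [← LinearMap.finrank_range_add_finrank_ker g, LinearMap.range_eq_top.2 hg, finrank_top,
    LinearMap.exact_iff.1 hfg, LinearMap.finrank_range_of_inj hf, add_comm]

universe w

variable (k : Type*) [Field k] {C : Type*} [Category C] [Abelian C] [Linear k C]
  [∀ X Y : C, Module.Finite k (X ⟶ Y)]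

lemma finrank_hom_eq_add_of_projective {S : ShortComplex C} (hS : S.ShortExact) (P : C)
    [Projective P] :
    Module.finrank k (P ⟶ S.X₂) = Module.finrank k (P ⟶ S.X₁) + Module.finrank k (P ⟶ S.X₃) := by
  have := hS.mono_f
  have := hS.epi_g
  refine finrank_eq_add_of_exact (f := Linear.rightComp k P S.f) (g := Linear.rightComp k P S.g)
    (fun _ _ => (cancel_mono S.f).1) (fun f => ⟨fun hf => ⟨hS.exact.lift f hf, ?_⟩, ?_⟩)
    fun f => ⟨Projective.factorThru f S.g, Projective.factorThru_comp f S.g⟩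
  · exact hS.exact.lift_f f hf
  · rintro ⟨g, rfl⟩
    simp

lemma finrank_hom_eq_add_of_subsingleton_ext [HasExt.{w} C] {S : ShortComplex C}
    (hS : S.ShortExact) (Y : C) [Subsingleton (Ext S.X₃ Y 1)] :
    Module.finrank k (S.X₂ ⟶ Y) = Module.finrank k (S.X₃ ⟶ Y) + Module.finrank k (S.X₁ ⟶ Y) := by
  have := hS.mono_f
  have := hS.epi_g
  refine finrank_eq_add_of_exact (f := Linear.leftComp k Y S.g) (g := Linear.leftComp k Y S.f)
    (fun _ _ => (cancel_epi S.g).1) (fun f => ⟨fun hf => ⟨hS.exact.desc f hf, ?_⟩, ?_⟩)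
    (exists_f_comp_eq_of_subsingleton_ext hS)
  · exact hS.exact.g_desc f hf
  · rintro ⟨g, rfl⟩
    simp

/-- The Euler form of `X`, read off a projective resolution of length one. -/
lemma exists_additiveFunctions_eq_finrank_hom [HasExt.{w} C] [EnoughProjectives C] (X : C)
    [HasProjectiveDimensionLE X 1] :
    ∃ χ ∈ additiveFunctions C, ∀ Y, Subsingleton (Ext X Y 1) →
      χ Y = Module.finrank k (X ⟶ Y) := by
  have hQ := shortExact_kernel (Projective.π X)
  have : Projective (kernel (Projective.π X)) :=
    projective_iff_hasProjectiveDimensionLT_one.2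
      ((hQ.hasProjectiveDimensionLT_X₃_iff 0
        (inferInstanceAs (Projective (Projective.over X)))).1 ‹_›)
  refine ⟨fun Y => Module.finrank k (Projective.over X ⟶ Y) -
    Module.finrank k (kernel (Projective.π X) ⟶ Y), fun S hS => ?_, fun Y _ => ?_⟩
  · simp only [finrank_hom_eq_add_of_projective k hS]
    push_cast
    ring
  · simp [finrank_hom_eq_add_of_subsingleton_ext k hQ Y]

end FiniteHom

section Chains

variable {C : Type*} [Category C] [Abelian C] [HasFiniteLength C] [EnoughProjectives C]
  (k : Type*) [Field k] [Linear k C] [∀ X Y : C, Module.Finite k (X ⟶ Y)]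

include k

/-- `End X` has no zero divisors, hence is a division ring, so that a nonzero `g : Y ⟶ X` would make
`f` a split monomorphism. -/
lemma IsLeft.hom_eq_zero {X Y : C} (hX : IsLeft X) (hX' : ReceivesInjective X) (hY : IsLeft Y)
    {f : X ⟶ Y} (hf : f ≠ 0) (hf' : ¬ IsIso f) (g : Y ⟶ X) : g = 0 := by
  by_contra hg
  have hfg : f ≫ g ≠ 0 := hX.comp_ne_zero_of_receivesInjective hX' hY hX hf hg
  have hinj : Function.Injective (Linear.leftComp k X (f ≫ g)) :=
    (injective_iff_map_eq_zero _).2 fun e he => by_contra fun he' =>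
      hX.comp_ne_zero_of_receivesInjective hX' hX hX hfg he' he
  obtain ⟨e, he⟩ := LinearMap.injective_iff_surjective.1 hinj (𝟙 X)
  exact hf' (isIso_of_retract_of_indecomposable ⟨f, g ≫ e, by simpa using he⟩ hX.1.1 hY.1).1

/-- The Euler forms of the `X i`, evaluated at the `X j`, form a triangular matrix with nonzero
diagonal. -/
lemma card_le_finrank_additiveFunctions [FiniteDimensional ℚ (additiveFunctions C)] {n : ℕ}
    {X : Fin n → C} (hX : ∀ i, IsLeft (X i)) (hX' : ∀ i, ReceivesInjective (X i))
    (h : ∀ i j, i < j → ∃ f : X i ⟶ X j, f ≠ 0 ∧ ¬ IsIso f) :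
    n ≤ Module.finrank ℚ (additiveFunctions C) := by
  let := HasExt.standard C
  have (i : Fin n) := (hX i).hasProjectiveDimensionLE
  choose χ hχ hχX using fun i => exists_additiveFunctions_eq_finrank_hom k (X i)
  have hM (i j : Fin n) : χ i (X j) = Module.finrank k (X i ⟶ X j) :=
    hχX i (X j) ((hX i).subsingleton_ext_one (hX j) (hX' j))
  let M : Matrix (Fin n) (Fin n) ℚ := .of fun i j => χ i (X j)
  have htri : M.IsUpperTriangular := fun i j hij => by
    obtain ⟨f, hf, hf'⟩ := h j i hij
    have : Subsingleton (X i ⟶ X j) := subsingleton_of_forall_eq 0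
      ((hX j).hom_eq_zero k (hX' j) (hX i) hf hf')
    simpa [M, hM] using Module.finrank_zero_of_subsingleton
  have hdet : M.det ≠ 0 := by
    rw [Matrix.det_of_isUpperTriangular htri, Finset.prod_ne_zero_iff]
    intro i _
    have := nontrivial_of_ne _ _ (id_ne_zero_of_indecomposable (hX i).1)
    simpa [M, hM] using Module.finrank_pos.ne'
  have hli : LinearIndependent ℚ fun i => (⟨χ i, hχ i⟩ : additiveFunctions C) :=
    .of_comp ((LinearMap.funLeft ℚ ℚ X).comp (additiveFunctions C).subtype)
      (Matrix.linearIndependent_rows_of_det_ne_zero hdet)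
  simpa using hli.fintype_card_le_finrank

lemma IsLeft.length_lt_finrank [FiniteDimensional ℚ (additiveFunctions C)] {m : ℕ}
    {X : Fin (m + 1) → C} (hX : ∀ i : Fin m, Precedes (X i.castSucc) (X i.succ))
    (h : IsLeft (X (Fin.last m))) (h0 : Injective (X 0)) :
    m < Module.finrank ℚ (additiveFunctions C) := by
  have hL (i) : IsLeft (X i) :=
    Fin.reverseInduction h (fun i hi => hi.of_precedes (hX i)) i
  have hI (i) : ReceivesInjective (X i) := by
    refine Fin.induction ⟨X 0, h0, 𝟙 _, id_ne_zero_of_indecomposable (hL 0).1⟩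
      (fun i hi => ?_) i
    obtain ⟨-, -, f, hf, -⟩ := hX i
    exact (hL _).receivesInjective_of_hom hi (hL _) hf
  let r (i j : Fin (m + 1)) : Prop := ∃ f : X i ⟶ X j, f ≠ 0 ∧ ¬ IsIso f
  have : IsTrans _ r := ⟨fun i j l ⟨f, hf, hf'⟩ ⟨g, hg, _⟩ => by
    refine ⟨f ≫ g, (hL i).comp_ne_zero_of_receivesInjective (hI i) (hL j) (hL l) hf hg,
      fun hfg => hf' ?_⟩
    exact (isIso_of_retract_of_indecomposable ⟨f, g ≫ inv (f ≫ g), by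
      rw [← Category.assoc, IsIso.hom_inv_id]⟩ (hL i).1.1 (hL j).1).1⟩
  refine card_le_finrank_additiveFunctions k hL hI fun i j hij => ?_
  exact (Fin.liftFun_iff_succ (f := id) r).2 (fun i => (hX i).2.2) hij

end Chains

section Duality

variable {C : Type*} [Category C] [Abelian C]

lemma precedes_op_iff {X Y : C} :
    Precedes (Opposite.op X) (Opposite.op Y) ↔ Precedes Y X := by
  simp only [Precedes, indecomposable_op_iff]
  refine ⟨fun ⟨hX, hY, f, hf, hf'⟩ => ⟨hY, hX, f.unop, fun h => hf ?_, fun h => hf' ?_⟩,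
    fun ⟨hY, hX, f, hf, hf'⟩ => ⟨hX, hY, f.op, fun h => hf ?_, fun h => hf' ?_⟩⟩
  · exact congrArg Quiver.Hom.op h
  · exact (isIso_unop_iff f).1 h
  · exact congrArg Quiver.Hom.unop h
  · exact (isIso_op_iff f).1 h

lemma reflTransGen_precedes_op_iff {X Y : C} :
    ReflTransGen Precedes (Opposite.op X) (Opposite.op Y) ↔ ReflTransGen Precedes Y X := by
  rw [← reflTransGen_swap]
  refine ⟨fun h => h.lift Opposite.unop fun A B hAB => ?_, fun h => h.lift Opposite.op
    fun A B hAB => ?_⟩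
  · exact precedes_op_iff.1 hAB
  · exact precedes_op_iff.2 hAB

lemma hasProjectiveDimensionLE_one_op_iff [EnoughInjectives C] {X : C} :
    HasProjectiveDimensionLE (Opposite.op X) 1 ↔ HasInjectiveDimensionLE X 1 := by
  have h := shortExact_cokernel (Injective.ι X)
  have hI := h.hasInjectiveDimensionLT_X₃_iff 0
    (inferInstanceAs (Injective (Injective.under X)))
  have hP := h.op.hasProjectiveDimensionLT_X₃_iff 0
    (inferInstanceAs (Projective (Opposite.op (Injective.under X))))
  rw [← injective_iff_hasInjectiveDimensionLT_one] at hI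
  rw [← projective_iff_hasProjectiveDimensionLT_one] at hP
  exact hP.trans (Injective.injective_iff_projective_op.symm.trans hI)

lemma isLeft_op_iff [EnoughInjectives C] {X : C} : IsLeft (Opposite.op X) ↔ IsRight X := by
  refine and_congr indecomposable_op_iff
    (Opposite.op_surjective.forall.trans (forall_congr' fun W => ?_))
  rw [reflTransGen_precedes_op_iff, hasProjectiveDimensionLE_one_op_iff]

variable [HasFiniteLength C] [EnoughInjectives C]

lemma exists_projective_reflTransGen_precedes [EnoughProjectives C] {X : C}
    (hX : Indecomposable X) (h : ¬ HasInjectiveDimensionLE X 1) :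
    ∃ P, Indecomposable P ∧ Projective P ∧ ReflTransGen Precedes X P := by
  obtain ⟨J, hJ, hJ', hJX⟩ := exists_injective_reflTransGen_precedes
    (indecomposable_op_iff.2 hX) (mt hasProjectiveDimensionLE_one_op_iff.1 h)
  exact ⟨J.unop, indecomposable_op_iff.1 hJ, inferInstance, reflTransGen_precedes_op_iff.1 hJX⟩

lemma IsRight.length_lt_finrank (k : Type*) [Field k] [Linear k C]
    [∀ X Y : C, Module.Finite k (X ⟶ Y)] [FiniteDimensional ℚ (additiveFunctions C)] {m : ℕ}
    {X : Fin (m + 1) → C} (hX : ∀ i : Fin m, Precedes (X i.castSucc) (X i.succ))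
    (h : IsRight (X 0)) (hm : Projective (X (Fin.last m))) :
    m < Module.finrank ℚ (additiveFunctions Cᵒᵖ) := by
  refine IsLeft.length_lt_finrank k (X := fun i => Opposite.op (X i.rev)) (fun i => ?_) ?_ ?_
  · simpa [precedes_op_iff, Fin.rev_castSucc, Fin.rev_succ] using hX i.rev
  · simpa [isLeft_op_iff] using h
  · rw [Fin.rev_zero]
    infer_instance

end Duality

section Simples

variable {C : Type*} [Category C] [Abelian C] [HasFiniteLength C]

lemma exists_simple_mono {X : C} (hX : ¬ IsZero X) : ∃ (T : C) (i : T ⟶ X), Simple T ∧ Mono i := by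
  induction hn : length X using Nat.strong_induction_on generalizing X with
  | _ n ih =>
  by_cases h : ∀ (Y : C) (f : Y ⟶ X) [Mono f], f ≠ 0 → IsIso f
  · exact ⟨X, 𝟙 X, ⟨fun f => ⟨fun _ h0 => hX (.of_epi_eq_zero f h0), h _ f⟩⟩, inferInstance⟩
  · push Not at h
    obtain ⟨Y, f, _, hf, hf'⟩ := h
    obtain ⟨T, i, hT, _⟩ := ih _ (hn ▸ length_lt_of_mono f hf')
      (fun hY => hf (hY.eq_of_src f 0)) rfl
    exact ⟨T, i ≫ f, hT, inferInstance⟩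

lemma length_cokernel_lt_of_simple {T X : C} [Simple T] (i : T ⟶ X) [Mono i] :
    length (cokernel i) < length X := by
  have hadd : length X = length T + length (cokernel i) := length_eq_add (shortExact_cokernel i)
  have : length T ≠ 0 := fun h => Simple.not_isZero T (isZero_of_length_eq_zero h)
  lia

lemma exists_finset_simple_quotients (G : C) :
    ∃ s : Finset C, ∀ (T : C) [Simple T] (f : G ⟶ T), f ≠ 0 → ∃ T' ∈ s, Nonempty (T' ≅ T) := by
  induction hn : length G using Nat.strong_induction_on generalizing G with
  | _ n ih =>
  by_cases hG : IsZero G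
  · exact ⟨∅, fun T _ f hf => (hf (hG.eq_of_src f 0)).elim⟩
  obtain ⟨T₀, i, _, _⟩ := exists_simple_mono hG
  obtain ⟨s, hs⟩ := ih _ (hn ▸ length_cokernel_lt_of_simple i) (cokernel i) rfl
  classical
  refine ⟨insert T₀ s, fun T _ f hf => ?_⟩
  by_cases h : i ≫ f = 0
  · obtain ⟨T', hT', e⟩ := hs T (cokernel.desc i f h) fun h0 => hf (by
      rw [← cokernel.π_desc i f h, h0, comp_zero])
    exact ⟨T', Finset.mem_insert_of_mem hT', e⟩
  · have := isIso_of_hom_simple h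
    exact ⟨T₀, Finset.mem_insert_self _ _, ⟨asIso (i ≫ f)⟩⟩

lemma eq_zero_of_mem_additiveFunctions {f : C → ℚ} (hf : f ∈ additiveFunctions C)
    (h : ∀ T, Simple T → f T = 0) : f = 0 := by
  ext X
  induction hn : length X using Nat.strong_induction_on generalizing X with
  | _ n ih =>
  by_cases hX : IsZero X
  · exact apply_eq_zero_of_mem_additiveFunctions hf hX
  obtain ⟨T, i, hT, _⟩ := exists_simple_mono hX
  have hf : f X = f T + f (cokernel i) := hf _ (shortExact_cokernel i)
  rw [hf, h T hT, ih _ (hn ▸ length_cokernel_lt_of_simple i) (cokernel i) rfl]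
  exact add_zero 0

lemma finiteDimensional_additiveFunctions {G : C} (hG : IsSeparator G) :
    FiniteDimensional ℚ (additiveFunctions C) := by
  obtain ⟨s, hs⟩ := exists_finset_simple_quotients G
  let restrict : additiveFunctions C →ₗ[ℚ] s → ℚ :=
    (LinearMap.funLeft ℚ ℚ Subtype.val).comp (additiveFunctions C).subtype
  refine .of_injective restrict ((injective_iff_map_eq_zero restrict).2 fun f hf => ?_)
  refine Subtype.ext (eq_zero_of_mem_additiveFunctions f.2 fun T _ => ?_)
  obtain ⟨h, hh⟩ : ∃ h : G ⟶ T, h ≠ 0 := by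
    by_contra! h
    exact id_nonzero T (hG.def _ _ fun g => by rw [h g, zero_comp, zero_comp])
  obtain ⟨T', hT', ⟨e⟩⟩ := hs T h hh
  rw [← apply_eq_of_mem_additiveFunctions f.2 e]
  exact congr_fun hf ⟨T', hT'⟩

end Simples

section EnoughObjects

variable {C D : Type*} [Category C] [Category D] (F : C ⥤ D)

lemma enoughProjectives_of_exists_epi [F.Full] [F.Faithful] [F.PreservesEpimorphisms]
    (h : ∀ X : C, ∃ (P : C) (f : P ⟶ X), Projective (F.obj P) ∧ Epi f) : EnoughProjectives C where
  presentation X := by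
    obtain ⟨P, f, hP, _⟩ := h X
    have := F.projective_of_map_projective hP
    exact ⟨{ p := P, f := f }⟩

lemma preservesProjectiveObjects_of_exists_epi
    (h : ∀ X : C, ∃ (P : C) (f : P ⟶ X), Projective (F.obj P) ∧ Epi f) :
    F.PreservesProjectiveObjects where
  projective_obj {Q} _ := by
    obtain ⟨P, f, hP, _⟩ := h Q
    let ρ : Retract Q P := ⟨Projective.factorThru (𝟙 Q) f, f, Projective.factorThru_comp _ _⟩
    exact (ρ.map F).projective

lemma enoughInjectives_of_exists_mono [F.Full] [F.Faithful] [F.PreservesMonomorphisms]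
    (h : ∀ X : C, ∃ (J : C) (f : X ⟶ J), Injective (F.obj J) ∧ Mono f) : EnoughInjectives C where
  presentation X := by
    obtain ⟨J, f, hJ, _⟩ := h X
    have := F.injective_of_map_injective hJ
    exact ⟨{ J := J, f := f }⟩

lemma preservesInjectiveObjects_of_exists_mono
    (h : ∀ X : C, ∃ (J : C) (f : X ⟶ J), Injective (F.obj J) ∧ Mono f) :
    F.PreservesInjectiveObjects where
  injective_obj {Q} _ := by
    obtain ⟨J, f, hJ, _⟩ := h Q
    let ρ : Retract Q J := ⟨f, Injective.factorThru (𝟙 Q) f, Injective.comp_factorThru _ _⟩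
    exact (ρ.map F).injective

end EnoughObjects

section ExactFunctor

variable {C D : Type*} [Category C] [Category D] [Abelian C] [Abelian D] (F : C ⥤ D)
  [PreservesFiniteLimits F] [PreservesFiniteColimits F]

lemma hasProjectiveDimensionLE_one_map_iff [F.Full] [F.Faithful] [F.PreservesProjectiveObjects]
    [EnoughProjectives C] {X : C} :
    HasProjectiveDimensionLE (F.obj X) 1 ↔ HasProjectiveDimensionLE X 1 := by
  have h := shortExact_kernel (Projective.π X)
  have hC := h.hasProjectiveDimensionLT_X₃_iff 0
    (inferInstanceAs (Projective (Projective.over X)))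
  have hD := (h.map_of_exact F).hasProjectiveDimensionLT_X₃_iff 0
    (F.projective_obj (Projective.over X))
  rw [← projective_iff_hasProjectiveDimensionLT_one] at hC hD
  exact hD.trans (.trans ⟨fun h => F.projective_of_map_projective h,
    fun _ => F.projective_obj _⟩ hC.symm)

lemma hasInjectiveDimensionLE_one_map_iff [F.Full] [F.Faithful] [F.PreservesInjectiveObjects]
    [EnoughInjectives C] {X : C} :
    HasInjectiveDimensionLE (F.obj X) 1 ↔ HasInjectiveDimensionLE X 1 := by
  have h := shortExact_cokernel (Injective.ι X)
  have hC := h.hasInjectiveDimensionLT_X₃_iff 0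
    (inferInstanceAs (Injective (Injective.under X)))
  have hD := (h.map_of_exact F).hasInjectiveDimensionLT_X₃_iff 0
    (F.injective_obj (Injective.under X))
  rw [← injective_iff_hasInjectiveDimensionLT_one] at hC hD
  exact hD.symm.trans (.trans ⟨fun h => F.injective_of_map_injective h,
    fun _ => F.injective_obj _⟩ hC)

end ExactFunctor

section FiniteModules

open scoped ModuleCat.Algebra

/-- The inclusion of the finitely generated modules into all modules. -/
abbrev inclusion (R : Type u) [Ring R] : FGModuleCat.{u} R ⥤ ModuleCat.{u} R := forget₂ _ _

variable {R : Type u} [Ring R]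

lemma exists_projective_obj_epi (X : FGModuleCat.{u} R) :
    ∃ (P : FGModuleCat R) (f : P ⟶ X),
      Projective ((inclusion R).obj P) ∧ Epi f := by
  obtain ⟨n, f, hf⟩ := Module.Finite.exists_fin' R X
  refine ⟨.of R (Fin n → R), FGModuleCat.ofHom f, ?_, ?_⟩
  · exact (IsProjective.iff_projective _).1 (inferInstanceAs (Module.Projective R (Fin n → R)))
  · exact (inclusion R).epi_of_epi_map
      ((ModuleCat.epi_iff_surjective _).2 hf)

variable (R) in
lemma isSeparator_of_self : IsSeparator (FGModuleCat.of R R) := by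
  refine (isSeparator_def _).2 fun X Y f g h => FGModuleCat.hom_ext (LinearMap.ext fun x => ?_)
  have hx : f.hom.hom ((1 : R) • x) = g.hom.hom ((1 : R) • x) := LinearMap.congr_fun
    (congrArg (fun a => a.hom.hom) (h (FGModuleCat.ofHom (LinearMap.toSpanSingleton R X x)))) 1
  rwa [one_smul] at hx

section Noetherian

variable [IsNoetherianRing R]

instance : EnoughProjectives (FGModuleCat.{u} R) :=
  enoughProjectives_of_exists_epi (inclusion R) exists_projective_obj_epi

instance : (inclusion R).PreservesProjectiveObjects :=
  preservesProjectiveObjects_of_exists_epi _ exists_projective_obj_epi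

instance [IsArtinianRing R] : HasFiniteLength (FGModuleCat.{u} R) where
  exists_length := by
    refine ⟨fun X => (Module.length R X).toNat, fun S hS => ?_, fun X h0 => ?_⟩
    · have hS := hS.map_of_exact (inclusion R)
      have hadd : Module.length R S.X₂ = Module.length R S.X₁ + Module.length R S.X₃ :=
        Module.length_eq_add_of_exact _ _ hS.moduleCat_injective_f hS.moduleCat_surjective_g
          ((ShortComplex.ShortExact.moduleCat_exact_iff_function_exact _).1 hS.exact)
      dsimp only
      rw [hadd, ENat.toNat_add Module.length_ne_top Module.length_ne_top]
    · have : Subsingleton X := Module.length_eq_zero_iff.1 <|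
        (ENat.toNat_eq_zero.1 h0).resolve_right Module.length_ne_top
      exact (isZero_map_iff (inclusion R)).1
        (ModuleCat.isZero_of_subsingleton X.obj)

end Noetherian

section FiniteDimensional

variable (k : Type*) [Field k] [Algebra k R]

lemma injective_coextendScalars (V : ModuleCat.{u} k) :
    Injective ((ModuleCat.coextendScalars.{_, _, u} (algebraMap k R)).obj V) := by
  have : Injective V := by
    rw [← Module.injective_iff_injective_object]
    exact Module.injective_of_isSemisimpleRing _ _
  exact Injective.injective_of_adjoint (ModuleCat.restrictCoextendScalarsAdj.{u} (algebraMap k R)) V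

variable [Module.Finite k R]

lemma finite_hom (X Y : FGModuleCat.{u} R) : Module.Finite k (X ⟶ Y) := by
  have : Module.Finite k X.obj := Module.Finite.trans R X
  have : Module.Finite k Y.obj := Module.Finite.trans R Y
  have : Module.Finite k (X.obj →ₗ[R] Y.obj) :=
    .of_injective (LinearMap.restrictScalarsₗ k R X.obj Y.obj k)
      (LinearMap.restrictScalars_injective k)
  exact .equiv (InducedCategory.homLinearEquiv.trans ModuleCat.homLinearEquiv).symm

lemma finite_coextendScalars (V : ModuleCat.{u} k) [Module.Finite k V] :
    Module.Finite R ((ModuleCat.coextendScalars.{_, _, u} (algebraMap k R)).obj V) := by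
  let ofSelf : R →ₗ[k] (ModuleCat.restrictScalars.{u} (algebraMap k R)).obj (ModuleCat.of R R) :=
    { toFun := fun r => r
      map_add' := fun _ _ => rfl
      map_smul' := Algebra.smul_def }
  have : Module.Finite k
      ((ModuleCat.restrictScalars.{u} (algebraMap k R)).obj (ModuleCat.of R R)) :=
    .of_surjective ofSelf Function.surjective_id
  let toHom : (ModuleCat.coextendScalars.{_, _, u} (algebraMap k R)).obj V →ₗ[k]
      ((ModuleCat.restrictScalars.{u} (algebraMap k R)).obj (ModuleCat.of R R) →ₗ[k] V) :=
    { toFun := fun g => ModuleCat.CoextendScalars.equiv _ _ g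
      map_add' := fun _ _ => rfl
      map_smul' := fun c g => by
        refine LinearMap.ext fun (s : R) => ?_
        change ModuleCat.CoextendScalars.equiv _ _ g (s * algebraMap k R c : R) = _
        rw [← Algebra.commutes c s]
        exact (ModuleCat.CoextendScalars.equiv _ _ g).map_smul c s }
  have : Module.Finite k ((ModuleCat.coextendScalars.{_, _, u} (algebraMap k R)).obj V) :=
    .of_injective toHom (ModuleCat.CoextendScalars.equiv _ _).injective
  exact .of_restrictScalars_finite k R _

include k in
lemma exists_injective_obj_mono (X : FGModuleCat.{u} R) :
    ∃ (J : FGModuleCat R) (f : X ⟶ J),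
      Injective ((inclusion R).obj J) ∧ Mono f := by
  let F := ModuleCat.restrictScalars.{u} (algebraMap k R)
  let adj := ModuleCat.restrictCoextendScalarsAdj.{u} (algebraMap k R)
  have : Module.Finite k (F.obj X.obj) := Module.Finite.trans (M := X) (R := k) R
  refine ⟨⟨_, finite_coextendScalars k (F.obj X.obj)⟩, ⟨adj.unit.app X.obj⟩,
    injective_coextendScalars k _, ?_⟩
  exact (inclusion R).mono_of_mono_map
    (inferInstanceAs (Mono (adj.unit.app X.obj)))

end FiniteDimensional

end FiniteModules

section Paths

variable {A : Type u} [Ring A]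

lemma IsPath.trans {X Y Z : RightMod A} {s t : ℕ} (p : IsPath X Y s) (q : IsPath Y Z t) :
    IsPath X Z (s + t) := by
  induction p with
  | nil => rwa [zero_add]
  | cons hX f hf hf' _ ih => exact Nat.succ_add _ t ▸ .cons hX f hf hf' (ih q)

lemma IsPath.source_mem_ind {X Y : RightMod A} {s : ℕ} (p : IsPath X Y s) : X ∈ ind A := by
  cases p <;> assumption

lemma IsPath.target_mem_ind {X Y : RightMod A} {s : ℕ} (p : IsPath X Y s) : Y ∈ ind A := by
  induction p <;> assumption

lemma IsPath.exists_of_add {X Z : RightMod A} (s : ℕ) {t : ℕ} (p : IsPath X Z (s + t)) :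
    ∃ Y, IsPath X Y s ∧ IsPath Y Z t := by
  induction s generalizing X with
  | zero => exact ⟨X, .nil p.source_mem_ind, by rwa [zero_add] at p⟩
  | succ s ih =>
    rw [Nat.succ_add] at p
    obtain _ | ⟨hX, f, hf, hf', p⟩ := p
    obtain ⟨Y, p, q⟩ := ih p
    exact ⟨Y, .cons hX f hf hf' p, q⟩

variable [IsNoetherianRing Aᵐᵒᵖ]

lemma mem_ind_iff {X : FGModuleCat Aᵐᵒᵖ} : X.obj ∈ ind A ↔ Indecomposable X :=
  (and_iff_right X.property).trans (indecomposable_map_iff (inclusion Aᵐᵒᵖ))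

omit [IsNoetherianRing Aᵐᵒᵖ] in
lemma obj_injective :
    Function.Injective (ObjectProperty.FullSubcategory.obj : FGModuleCat Aᵐᵒᵖ → RightMod A) := by
  rintro ⟨X, hX⟩ ⟨Y, hY⟩ rfl
  rfl

lemma exists_fin_of_isPath {M N : RightMod A} {s : ℕ} (h : IsPath M N s) :
    ∃ X : Fin (s + 1) → FGModuleCat Aᵐᵒᵖ, (X 0).obj = M ∧ (X (Fin.last s)).obj = N ∧
      Indecomposable (X 0) ∧ ∀ i : Fin s, Precedes (X i.castSucc) (X i.succ) := by
  induction h with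
  | @nil M hM => exact ⟨fun _ => ⟨M, hM.1⟩, rfl, rfl, mem_ind_iff.1 hM, fun i => i.elim0⟩
  | @cons M Y N s hM f hf hf' p ih =>
    obtain ⟨X, rfl, rfl, hX, h⟩ := ih
    refine ⟨Fin.cons ⟨M, hM.1⟩ X, rfl, rfl, mem_ind_iff.1 hM, Fin.cases ?_ fun i => ?_⟩
    · exact (precedes_map_iff (inclusion Aᵐᵒᵖ)).1 ⟨hM.2, (mem_ind_iff.2 hX).2, f, hf, hf'⟩
    · exact h i

lemma exists_isPath_iff {X Y : FGModuleCat Aᵐᵒᵖ} :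
    (∃ s, IsPath X.obj Y.obj s) ↔ Indecomposable X ∧ ReflTransGen Precedes X Y := by
  refine ⟨fun ⟨s, p⟩ => ?_, fun ⟨hX, h⟩ => ?_⟩
  · obtain ⟨Z, hX, hY, hZ, h⟩ := exists_fin_of_isPath p
    obtain rfl : Z 0 = X := obj_injective hX
    obtain rfl : Z (Fin.last s) = Y := obj_injective hY
    exact ⟨hZ, Fin.induction (motive := fun i => ReflTransGen Precedes (Z 0) (Z i)) .refl
      (fun i hi => hi.tail (h i)) _⟩
  · induction h using ReflTransGen.head_induction_on with
    | refl => exact ⟨0, .nil (mem_ind_iff.2 hX)⟩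
    | head h h' ih =>
      obtain ⟨s, p⟩ := ih ⟨h.2.1, h'⟩ h.2.1
      obtain ⟨_, _, f, hf, hf'⟩ := (precedes_map_iff (inclusion Aᵐᵒᵖ)).2 h
      exact ⟨s + 1, .cons (mem_ind_iff.2 hX) f hf hf' p⟩

lemma mem_leftPart_iff {X : FGModuleCat Aᵐᵒᵖ} : X.obj ∈ leftPart A ↔ IsLeft X := by
  refine (and_congr_left' mem_ind_iff).trans
    (and_congr_right fun hX => ⟨fun h W hW => ?_, fun h W s p => ?_⟩)
  · obtain ⟨s, p⟩ := exists_isPath_iff.2 ⟨(indecomposable_iff_of_reflTransGen hW).2 hX, hW⟩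
    exact (hasProjectiveDimensionLE_one_map_iff (inclusion Aᵐᵒᵖ)).1 (h W.obj s p)
  · let W' : FGModuleCat Aᵐᵒᵖ := ⟨W, p.source_mem_ind.1⟩
    exact (hasProjectiveDimensionLE_one_map_iff (inclusion Aᵐᵒᵖ)).2
      (h W' (exists_isPath_iff.1 ⟨s, p⟩).2)

lemma mem_rightPart_iff [EnoughInjectives (FGModuleCat.{u} Aᵐᵒᵖ)]
    [(inclusion Aᵐᵒᵖ).PreservesInjectiveObjects] {X : FGModuleCat Aᵐᵒᵖ} :
    X.obj ∈ rightPart A ↔ IsRight X := by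
  refine (and_congr_left' mem_ind_iff).trans
    (and_congr_right fun hX => ⟨fun h W hW => ?_, fun h W s p => ?_⟩)
  · obtain ⟨s, p⟩ := exists_isPath_iff.2 ⟨hX, hW⟩
    exact (hasInjectiveDimensionLE_one_map_iff (inclusion Aᵐᵒᵖ)).1 (h W.obj s p)
  · let W' : FGModuleCat Aᵐᵒᵖ := ⟨W, p.target_mem_ind.1⟩
    exact (hasInjectiveDimensionLE_one_map_iff (inclusion Aᵐᵒᵖ)).2
      (h W' (exists_isPath_iff.1 ⟨s, p⟩).2)

variable [IsArtinianRing Aᵐᵒᵖ]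

open scoped ModuleCat.Algebra in
lemma exists_length_lt_of_injective_of_mem_leftPart (k : Type*) [Field k] [Algebra k Aᵐᵒᵖ]
    [∀ X Y : FGModuleCat.{u} Aᵐᵒᵖ, Module.Finite k (X ⟶ Y)] :
    ∃ n, ∀ (J X : RightMod A) (m : ℕ), Injective J → X ∈ leftPart A → IsPath J X m → m < n := by
  have := finiteDimensional_additiveFunctions (isSeparator_of_self Aᵐᵒᵖ)
  refine ⟨Module.finrank ℚ (additiveFunctions (FGModuleCat.{u} Aᵐᵒᵖ)), fun J X m hJ hX p => ?_⟩
  obtain ⟨Z, rfl, rfl, -, h⟩ := exists_fin_of_isPath p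
  exact IsLeft.length_lt_finrank k h (mem_leftPart_iff.1 hX)
    ((inclusion Aᵐᵒᵖ).injective_of_map_injective hJ)

variable [EnoughInjectives (FGModuleCat.{u} Aᵐᵒᵖ)] [(inclusion Aᵐᵒᵖ).PreservesInjectiveObjects]

lemma exists_injective_isPath_of_notMem_leftPart {X : RightMod A} (hX : X ∈ ind A)
    (h : X ∉ leftPart A) : ∃ (J : RightMod A) (s : ℕ), Injective J ∧ IsPath J X s := by
  obtain ⟨W, s, p, hW⟩ : ∃ W s, IsPath W X s ∧ ¬ HasProjectiveDimensionLE W 1 := by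
    by_contra! h'
    exact h ⟨hX, h'⟩
  let W' : FGModuleCat Aᵐᵒᵖ := ⟨W, p.source_mem_ind.1⟩
  obtain ⟨J, hJ, _, hJW⟩ := exists_injective_reflTransGen_precedes
    (X := W') (mem_ind_iff.1 p.source_mem_ind)
    (mt (hasProjectiveDimensionLE_one_map_iff (inclusion Aᵐᵒᵖ)).2 hW)
  obtain ⟨t, q⟩ := exists_isPath_iff.2 ⟨hJ, hJW⟩
  exact ⟨J.obj, t + s, (inclusion Aᵐᵒᵖ).injective_obj J, q.trans p⟩

lemma exists_projective_isPath_of_notMem_rightPart {X : RightMod A} (hX : X ∈ ind A)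
    (h : X ∉ rightPart A) : ∃ (P : RightMod A) (s : ℕ), Projective P ∧ IsPath X P s := by
  obtain ⟨W, s, p, hW⟩ : ∃ W s, IsPath X W s ∧ ¬ HasInjectiveDimensionLE W 1 := by
    by_contra! h'
    exact h ⟨hX, h'⟩
  let W' : FGModuleCat Aᵐᵒᵖ := ⟨W, p.target_mem_ind.1⟩
  have hW' : Indecomposable W' := mem_ind_iff.1 p.target_mem_ind
  obtain ⟨P, _, _, hWP⟩ := exists_projective_reflTransGen_precedes
    (X := W') hW'
    (mt (hasInjectiveDimensionLE_one_map_iff (inclusion Aᵐᵒᵖ)).2 hW)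
  obtain ⟨t, q⟩ := exists_isPath_iff.2 ⟨hW', hWP⟩
  exact ⟨P.obj, s + t, (inclusion Aᵐᵒᵖ).projective_obj P, p.trans q⟩

open scoped ModuleCat.Algebra in
lemma exists_length_lt_of_projective_of_mem_rightPart (k : Type*) [Field k] [Algebra k Aᵐᵒᵖ]
    [∀ X Y : FGModuleCat.{u} Aᵐᵒᵖ, Module.Finite k (X ⟶ Y)] :
    ∃ n, ∀ (X P : RightMod A) (m : ℕ), X ∈ rightPart A → Projective P → IsPath X P m → m < n := by
  have := finiteDimensional_additiveFunctions (isSeparator_of_self Aᵐᵒᵖ)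
  refine ⟨Module.finrank ℚ (additiveFunctions (FGModuleCat.{u} Aᵐᵒᵖ)ᵒᵖ), fun X P m hX hP p => ?_⟩
  obtain ⟨Z, rfl, rfl, -, h⟩ := exists_fin_of_isPath p
  exact IsRight.length_lt_finrank k h (mem_rightPart_iff.1 hX)
    ((inclusion Aᵐᵒᵖ).projective_of_map_projective hP)

end Paths

section ExtensionClosed

variable {C D : Type*} [Category C] [Category D] [Abelian C] [Abelian D] (F : C ⥤ D) [F.Full]
  [F.Faithful] [F.Additive] [PreservesFiniteLimits F] [PreservesFiniteColimits F]

section Ext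

universe w w'

variable [HasExt.{w} C] [HasExt.{w'} D]

lemma mapExactFunctor_one_injective [EnoughProjectives C] {X Y : C} :
    Function.Injective (Ext.mapExactFunctor F : Ext X Y 1 → Ext (F.obj X) (F.obj Y) 1) := by
  refine (injective_iff_map_eq_zero (F.mapExtAddHom X Y 1)).2 fun x hx => ?_
  obtain ⟨E, i, p, hip, hS, rfl⟩ := exists_shortExact_extClass_eq x
  obtain ⟨r, hr⟩ := (extClass_eq_zero_iff (hS.map_of_exact F)).1
    ((Ext.mapExactFunctor_extClass F hS).symm.trans hx)
  obtain ⟨r, rfl⟩ := F.map_surjective r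
  exact (extClass_eq_zero_iff hS).2
    ⟨r, F.map_injective ((F.map_comp _ _).trans (hr.trans (F.map_id _).symm))⟩

variable [F.essImage.IsClosedUnderExtensions] [EnoughProjectives D]

lemma mapExactFunctor_one_surjective {X Y : C} :
    Function.Surjective (Ext.mapExactFunctor F : Ext X Y 1 → Ext (F.obj X) (F.obj Y) 1) := by
  intro x
  obtain ⟨E, i, p, hip, hS, rfl⟩ := exists_shortExact_extClass_eq x
  obtain ⟨E', ⟨e⟩⟩ := F.essImage.prop_X₂_of_shortExact hS (F.obj_mem_essImage Y)
    (F.obj_mem_essImage X)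
  obtain ⟨i', hi'⟩ := F.map_surjective (i ≫ e.inv)
  obtain ⟨p', hp'⟩ := F.map_surjective (e.hom ≫ p)
  have hip' : i' ≫ p' = 0 := F.map_injective (by
    rw [F.map_comp, hi', hp', F.map_zero, Category.assoc, e.inv_hom_id_assoc, hip])
  let α : (ShortComplex.mk i' p' hip').map F ≅ ShortComplex.mk i p hip :=
    ShortComplex.isoMk (Iso.refl _) e (Iso.refl _)
      ((Category.id_comp _).trans ((Iso.eq_comp_inv e).1 hi').symm)
      (hp'.symm.trans (Category.comp_id _).symm)
  have hS' := ShortExact.reflects_shortExact_of_faithful F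
    (ShortComplex.shortExact_of_iso α.symm hS)
  refine ⟨hS'.extClass, ?_⟩
  rw [Ext.mapExactFunctor_extClass]
  exact (Ext.comp_mk₀_id _).symm.trans
    (((hS'.map_of_exact F).extClass_naturality hS α.hom).trans (Ext.mk₀_id_comp _))

lemma mapExactFunctor_two_injective [EnoughProjectives C] [EnoughInjectives C] {X Y : C} :
    Function.Injective (Ext.mapExactFunctor F : Ext X Y 2 → Ext (F.obj X) (F.obj Y) 2) := by
  refine (injective_iff_map_eq_zero (F.mapExtAddHom X Y 2)).2 fun x hx => ?_
  have hS := shortExact_cokernel (Injective.ι Y)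
  obtain ⟨y, rfl⟩ := Ext.covariant_sequence_exact₁ X hS x
    (Ext.eq_zero_of_injective (I := Injective.under Y) _) (n₀ := 1) rfl
  rw [F.mapExtAddHom_apply, Ext.mapExactFunctor_comp, Ext.mapExactFunctor_extClass] at hx
  obtain ⟨z, hz⟩ := Ext.covariant_sequence_exact₃ (F.obj X) (hS.map_of_exact F) _ rfl hx
  obtain ⟨z, rfl⟩ := mapExactFunctor_one_surjective F z
  obtain rfl : y = z.comp (Ext.mk₀ (cokernel.π (Injective.ι Y))) (add_zero 1) :=
    mapExactFunctor_one_injective F (by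
      rw [Ext.mapExactFunctor_comp, Ext.mapExactFunctor_mk₀]
      exact hz.symm)
  rw [Ext.eq_zero_of_injective (I := Injective.under Y) z, Ext.zero_comp, Ext.zero_comp]

end Ext

variable [F.essImage.IsClosedUnderExtensions] [EnoughProjectives C] [EnoughInjectives C]
  [EnoughProjectives D]

lemma hasProjectiveDimensionLE_one_of_map {X : C}
    (h : HasProjectiveDimensionLE (F.obj X) 1) :
    HasProjectiveDimensionLE X 1 := by
  let := HasExt.standard C
  let := HasExt.standard D
  exact hasProjectiveDimensionLT_of_enoughInjectives X 2 fun Y => subsingleton_of_forall_eq 0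
    fun x => mapExactFunctor_two_injective F ((Ext.eq_zero_of_hasProjectiveDimensionLT _ 2
      le_rfl).trans (Ext.eq_zero_of_hasProjectiveDimensionLT _ 2 le_rfl).symm)

lemma hasInjectiveDimensionLE_one_of_map {Y : C}
    (h : HasInjectiveDimensionLE (F.obj Y) 1) :
    HasInjectiveDimensionLE Y 1 := by
  let := HasExt.standard C
  let := HasExt.standard D
  exact hasInjectiveDimensionLT_of_enoughProjectives Y 2 fun X => subsingleton_of_forall_eq 0
    fun x => mapExactFunctor_two_injective F ((Ext.eq_zero_of_hasInjectiveDimensionLT _ 2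
      le_rfl).trans (Ext.eq_zero_of_hasInjectiveDimensionLT _ 2 le_rfl).symm)

end ExtensionClosed

section ChangeOfRings

variable {R S : Type u} [Ring R] [Ring S] {φ : R →+* S}

instance : PreservesFiniteLimits (ModuleCat.restrictScalars.{u} φ) := ⟨fun _ _ _ => ⟨inferInstance⟩⟩

instance : PreservesFiniteColimits (ModuleCat.restrictScalars.{u} φ) :=
  ⟨fun _ _ _ => ⟨inferInstance⟩⟩

lemma full_restrictScalars (hφ : Function.Surjective φ) :
    (ModuleCat.restrictScalars.{u} φ).Full where
  map_surjective {X Y} g :=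
    ⟨ModuleCat.ofHom (X := X) (Y := Y)
      { toFun := fun x => g.hom x
        map_add' := fun x y => g.hom.map_add x y
        map_smul' := fun s x => by
          obtain ⟨r, rfl⟩ := hφ s
          exact g.hom.map_smul r x }, rfl⟩

lemma mem_essImage_restrictScalars_iff (hφ : Function.Surjective φ) {M : ModuleCat.{u} R} :
    (ModuleCat.restrictScalars.{u} φ).essImage M ↔ ∀ r ∈ RingHom.ker φ, ∀ m : M, r • m = 0 := by
  refine ⟨fun ⟨N, ⟨e⟩⟩ r hr m => ?_, fun h => ?_⟩
  · obtain ⟨n, rfl⟩ := e.toLinearEquiv.surjective m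
    have hrn : r • n = 0 := by
      rw [ModuleCat.restrictScalars.smul_def, RingHom.mem_ker.1 hr]
      exact zero_smul S (show N from n)
    exact (map_smul e.toLinearEquiv r n).symm.trans
      ((congrArg e.toLinearEquiv hrn).trans (map_zero _))
  · let : SMul S M := ⟨fun s m => Function.surjInv hφ s • m⟩
    have hsmul (r : R) (m : M) : φ r • m = r • m := sub_eq_zero.1 <|
      (sub_smul (Function.surjInv hφ (φ r)) r m).symm.trans <|
        h _ (by rw [RingHom.mem_ker, map_sub, Function.surjInv_eq hφ, sub_self]) m
    let : Module S M := hφ.moduleLeft φ hsmul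
    let N : ModuleCat.{u} S := ModuleCat.of S M
    let e : M ≃ₗ[R] (ModuleCat.restrictScalars.{u} φ).obj N :=
      { AddEquiv.refl M with map_smul' := fun r m => (hsmul r m).symm }
    exact ⟨N, ⟨e.toModuleIso.symm⟩⟩

lemma isClosedUnderExtensions_essImage_restrictScalars (hφ : Function.Surjective φ)
    (hker : IsIdempotentElem (RingHom.ker φ)) :
    (ModuleCat.restrictScalars.{u} φ).essImage.IsClosedUnderExtensions where
  prop_X₂_of_shortExact {S} hS h₁ h₃ := by
    rw [mem_essImage_restrictScalars_iff hφ] at *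
    intro r hr m
    have hle : RingHom.ker φ * RingHom.ker φ ≤ LinearMap.ker (LinearMap.toSpanSingleton R S.X₂ m) :=
      Ideal.mul_le.2 fun a ha b hb => by
        obtain ⟨n, hn⟩ := (ShortComplex.ShortExact.moduleCat_exact_iff_function_exact _).1 hS.exact
          (b • m) |>.1 (by rw [map_smul, h₃ b hb])
        rw [LinearMap.mem_ker, LinearMap.toSpanSingleton_apply, mul_smul, ← hn, ← map_smul, h₁ a ha,
          map_zero]
    exact hle (hker.symm ▸ hr)

lemma finite_restrictScalars (hφ : Function.Surjective φ) {X : ModuleCat.{u} S}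
    (hX : Module.Finite S X) : Module.Finite R ((ModuleCat.restrictScalars.{u} φ).obj X) := by
  let : Module R S := Module.compHom S φ
  let : Module R X := Module.compHom X φ
  have : IsScalarTower R S X := ⟨fun r s x => mul_smul (φ r) s x⟩
  have : Module.Finite R S := .of_surjective (LinearMap.toSpanSingleton R S 1) fun s =>
    (hφ s).imp fun r hr => (mul_one (φ r)).trans hr
  have : Module.Finite R X := .trans S X
  exact this

end ChangeOfRings

section WeaklyShod

variable (k : Type*) {A : Type u} [Field k] [Ring A] [Algebra k Aᵐᵒᵖ] [Module.Finite k Aᵐᵒᵖ]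
include k

lemma exists_injective_projective_isPath {X Y : RightMod A} {m : ℕ} (hX : X ∉ leftPart A)
    (hY : Y ∉ rightPart A) (p : IsPath X Y m) :
    ∃ (J P : RightMod A) (n : ℕ), m ≤ n ∧ Injective J ∧ Projective P ∧ IsPath J P n := by
  have := IsNoetherianRing.of_finite k Aᵐᵒᵖ
  have := IsArtinianRing.of_finite k Aᵐᵒᵖ
  have := enoughInjectives_of_exists_mono (inclusion Aᵐᵒᵖ) (exists_injective_obj_mono k)
  have := preservesInjectiveObjects_of_exists_mono (inclusion Aᵐᵒᵖ) (exists_injective_obj_mono k)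
  obtain ⟨J, s, hJ, q⟩ := exists_injective_isPath_of_notMem_leftPart p.source_mem_ind hX
  obtain ⟨P, t, hP, r⟩ := exists_projective_isPath_of_notMem_rightPart p.target_mem_ind hY
  exact ⟨J, P, _, by omega, hJ, hP, (q.trans p).trans r⟩

variable (A) in
lemma exists_isPath_notMem_of_injective_of_projective :
    ∃ n, ∀ (J P : RightMod A) (m : ℕ), Injective J → Projective P → IsPath J P (n + m + n) →
      ∃ X Y : RightMod A, X ∉ leftPart A ∧ Y ∉ rightPart A ∧ IsPath X Y m := by
  have := IsNoetherianRing.of_finite k Aᵐᵒᵖ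
  have := IsArtinianRing.of_finite k Aᵐᵒᵖ
  have := enoughInjectives_of_exists_mono (inclusion Aᵐᵒᵖ) (exists_injective_obj_mono k)
  have := preservesInjectiveObjects_of_exists_mono (inclusion Aᵐᵒᵖ) (exists_injective_obj_mono k)
  have := finite_hom (R := Aᵐᵒᵖ) k
  obtain ⟨a, ha⟩ := exists_length_lt_of_injective_of_mem_leftPart (A := A) k
  obtain ⟨b, hb⟩ := exists_length_lt_of_projective_of_mem_rightPart (A := A) k
  refine ⟨max a b, fun J P m hJ hP p => ?_⟩
  obtain ⟨Y, p, r⟩ := p.exists_of_add _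
  obtain ⟨X, q, p⟩ := p.exists_of_add _
  exact ⟨X, Y, fun hX => (ha J X _ hJ hX q).not_ge (le_max_left a b),
    fun hY => (hb Y P _ hY hP r).not_ge (le_max_right a b), p⟩

end WeaklyShod

section ChangeOfRings

variable {A B : Type u} [Ring A] [Ring B] {φ : Aᵐᵒᵖ →+* Bᵐᵒᵖ}

lemma restrictScalars_mem_ind (hφ : Function.Surjective φ) {X : RightMod B} (hX : X ∈ ind B) :
    (ModuleCat.restrictScalars.{u} φ).obj X ∈ ind A :=
  have := full_restrictScalars hφ
  ⟨finite_restrictScalars hφ hX.1, (indecomposable_map_iff _).2 hX.2⟩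

lemma IsPath.restrictScalars (hφ : Function.Surjective φ) {X Y : RightMod B} {s : ℕ}
    (p : IsPath X Y s) : IsPath ((ModuleCat.restrictScalars.{u} φ).obj X)
      ((ModuleCat.restrictScalars.{u} φ).obj Y) s := by
  induction p with
  | nil hX => exact .nil (restrictScalars_mem_ind hφ hX)
  | cons hX f hf hf' _ ih =>
    exact .cons (restrictScalars_mem_ind hφ hX) ((ModuleCat.restrictScalars.{u} φ).map f)
      (mt (ModuleCat.restrictScalars.{u} φ).map_eq_zero_iff.1 hf)
      (mt (isIso_iff_of_reflects_iso f _).1 hf') ih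

lemma CofiniteInInd.of_restrictScalars (hφ : Function.Surjective φ) {U : Set (RightMod A)}
    {V : Set (RightMod B)} (hU : CofiniteInInd A U)
    (h : ∀ X ∈ ind B, (ModuleCat.restrictScalars.{u} φ).obj X ∈ U → X ∈ V) :
    CofiniteInInd B V := by
  have := full_restrictScalars hφ
  let Φ : Quotient (isIsomorphicSetoid (RightMod B)) → Quotient (isIsomorphicSetoid (RightMod A)) :=
    Quotient.map (ModuleCat.restrictScalars.{u} φ).obj
      fun _ _ ⟨e⟩ => ⟨(ModuleCat.restrictScalars.{u} φ).mapIso e⟩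
  have hΦ : Function.Injective Φ := by
    rintro ⟨X⟩ ⟨Y⟩ hXY
    obtain ⟨e⟩ := Quotient.exact hXY
    exact Quotient.sound ⟨(ModuleCat.restrictScalars.{u} φ).preimageIso e⟩
  refine Set.Finite.of_finite_image (f := Φ) (hU.subset ?_) hΦ.injOn
  rintro _ ⟨_, ⟨X, ⟨hX, hX'⟩, rfl⟩, rfl⟩
  exact ⟨_, ⟨restrictScalars_mem_ind hφ hX, fun h' => hX' (h X hX h')⟩, rfl⟩

variable (hφ : Function.Surjective φ) (hker : IsIdempotentElem (RingHom.ker φ))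
include hφ hker

lemma hasProjectiveDimensionLE_one_of_restrictScalars {X : RightMod B}
    (h : HasProjectiveDimensionLE ((ModuleCat.restrictScalars.{u} φ).obj X) 1) :
    HasProjectiveDimensionLE X 1 :=
  have := full_restrictScalars hφ
  have := isClosedUnderExtensions_essImage_restrictScalars hφ hker
  hasProjectiveDimensionLE_one_of_map _ h

lemma hasInjectiveDimensionLE_one_of_restrictScalars {X : RightMod B}
    (h : HasInjectiveDimensionLE ((ModuleCat.restrictScalars.{u} φ).obj X) 1) :
    HasInjectiveDimensionLE X 1 :=
  have := full_restrictScalars hφ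
  have := isClosedUnderExtensions_essImage_restrictScalars hφ hker
  hasInjectiveDimensionLE_one_of_map _ h

lemma mem_leftPart_of_restrictScalars {X : RightMod B} (hX : X ∈ ind B)
    (h : (ModuleCat.restrictScalars.{u} φ).obj X ∈ leftPart A) : X ∈ leftPart B :=
  ⟨hX, fun _ s p => hasProjectiveDimensionLE_one_of_restrictScalars hφ hker
    (h.2 _ s (p.restrictScalars hφ))⟩

lemma mem_rightPart_of_restrictScalars {X : RightMod B} (hX : X ∈ ind B)
    (h : (ModuleCat.restrictScalars.{u} φ).obj X ∈ rightPart A) : X ∈ rightPart B :=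
  ⟨hX, fun _ s p => hasInjectiveDimensionLE_one_of_restrictScalars hφ hker
    (h.2 _ s (p.restrictScalars hφ))⟩

lemma IsLaura.of_surjective (h : IsLaura A) : IsLaura B :=
  CofiniteInInd.of_restrictScalars hφ h fun _ hX => .imp
    (mem_leftPart_of_restrictScalars hφ hker hX) (mem_rightPart_of_restrictScalars hφ hker hX)

lemma IsRightGlued.of_surjective (h : IsRightGlued A) : IsRightGlued B :=
  CofiniteInInd.of_restrictScalars hφ h fun _ => mem_leftPart_of_restrictScalars hφ hker

lemma IsLeftGlued.of_surjective (h : IsLeftGlued A) : IsLeftGlued B :=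
  CofiniteInInd.of_restrictScalars hφ h fun _ => mem_rightPart_of_restrictScalars hφ hker

lemma IsShod.of_surjective (h : IsShod A) : IsShod B := fun _ hX =>
  (h _ (restrictScalars_mem_ind hφ hX)).imp
    (hasProjectiveDimensionLE_one_of_restrictScalars hφ hker)
    (hasInjectiveDimensionLE_one_of_restrictScalars hφ hker)

lemma IsWeaklyShod.of_surjective (k : Type*) [Field k] [Algebra k Aᵐᵒᵖ]
    [Module.Finite k Aᵐᵒᵖ] (h : IsWeaklyShod A) : IsWeaklyShod B := by
  let : Algebra k Bᵐᵒᵖ := (φ.comp (algebraMap k Aᵐᵒᵖ)).toAlgebra' fun c b => by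
    obtain ⟨a, rfl⟩ := hφ b
    simp only [RingHom.comp_apply, ← map_mul, Algebra.commutes]
  have : Module.Finite k Bᵐᵒᵖ :=
    .of_surjective (AlgHom.toLinearMap { φ with commutes' := fun _ => rfl }) hφ
  obtain ⟨l, hl⟩ := h
  obtain ⟨n, hn⟩ := exists_isPath_notMem_of_injective_of_projective k B
  refine ⟨n + l + n, fun J P m hJ hP p => ?_⟩
  by_contra! hm
  obtain ⟨d, rfl⟩ := Nat.exists_eq_add_of_lt hm
  obtain ⟨X, Y, hX, hY, q⟩ := hn J P (l + d + 1) hJ hP (by convert p using 1; omega)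
  obtain ⟨J', P', m', hm', hJ', hP', r⟩ := exists_injective_projective_isPath k
    (mt (mem_leftPart_of_restrictScalars hφ hker q.source_mem_ind) hX)
    (mt (mem_rightPart_of_restrictScalars hφ hker q.target_mem_ind) hY) (q.restrictScalars hφ)
  have := hl J' P' m' hJ' hP' r
  omega

end ChangeOfRings

section Quotient

lemma isIdempotentElem_ker_op {R S : Type*} [Ring R] [Ring S] {φ : R →+* S}
    (h : IsIdempotentElem (RingHom.ker φ)) : IsIdempotentElem (RingHom.ker (RingHom.op φ)) := by
  refine le_antisymm Ideal.mul_le_left fun x hx => ?_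
  have hx' : x.unop ∈ RingHom.ker φ * RingHom.ker φ := by
    rw [h.eq]
    exact MulOpposite.op_injective hx
  rw [← MulOpposite.op_unop x]
  refine Submodule.mul_induction_on hx' (fun a ha b hb => ?_) fun a b => add_mem
  exact Ideal.mul_mem_mul (congrArg MulOpposite.op hb) (congrArg MulOpposite.op ha)

lemma isIdempotentElem_ker_mk'_span {R : Type*} [Ring R] {e : R} (he : IsIdempotentElem e) :
    IsIdempotentElem (RingHom.ker (TwoSidedIdeal.span {e}).ringCon.mk') := by
  set K := RingHom.ker (TwoSidedIdeal.span {e}).ringCon.mk'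
  have hK (x : R) : x ∈ K ↔ x ∈ TwoSidedIdeal.span {e} :=
    (RingCon.eq _).trans (TwoSidedIdeal.mem_iff _ _).symm
  have heK : e ∈ K := (hK e).2 (TwoSidedIdeal.subset_span rfl)
  have hle : TwoSidedIdeal.span {e} ≤ (K * K).toTwoSided :=
    TwoSidedIdeal.span_le.2 <| Set.singleton_subset_iff.2 <|
      Ideal.mem_toTwoSided.2 <| he.eq ▸ Ideal.mul_mem_mul heK heK
  exact le_antisymm Ideal.mul_le_left fun x hx => Ideal.mem_toTwoSided.1 (hle ((hK x).1 hx))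

end Quotient

end IdempotentQuotient

theorem theorem4p1_general {A B : Type u} [Ring A] [Ring B] {φ : A →+* B}
    (hφ : Function.Surjective φ) (hker : IsIdempotentElem (RingHom.ker φ)) :
    (IdempotentQuotient.IsLaura A → IdempotentQuotient.IsLaura B) ∧
    (IdempotentQuotient.IsRightGlued A → IdempotentQuotient.IsRightGlued B) ∧
    (IdempotentQuotient.IsLeftGlued A → IdempotentQuotient.IsLeftGlued B) ∧
    (∀ (k : Type*) [Field k] [Algebra k A] [FiniteDimensional k A],
      IdempotentQuotient.IsWeaklyShod A → IdempotentQuotient.IsWeaklyShod B) ∧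
    (IdempotentQuotient.IsShod A → IdempotentQuotient.IsShod B) := by
  have hφ' : Function.Surjective (RingHom.op φ) :=
    MulOpposite.op_surjective.comp (hφ.comp MulOpposite.unop_surjective)
  have hker' := IdempotentQuotient.isIdempotentElem_ker_op hker
  refine ⟨.of_surjective hφ' hker', .of_surjective hφ' hker', .of_surjective hφ' hker',
    fun k _ _ _ => ?_, .of_surjective hφ' hker'⟩
  have : Module.Finite k Aᵐᵒᵖ := .equiv (MulOpposite.opLinearEquiv k)
  exact .of_surjective hφ' hker' k

theorem theorem4p1 {k : Type*} [Field k] {A : Type u} [Ring A] [Algebra k A]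
    [FiniteDimensional k A] (e : A) (he : IsIdempotentElem e) :
    (IdempotentQuotient.IsLaura A →
      IdempotentQuotient.IsLaura (IdempotentQuotient.quotByIdeal e)) ∧
    (IdempotentQuotient.IsRightGlued A →
      IdempotentQuotient.IsRightGlued (IdempotentQuotient.quotByIdeal e)) ∧
    (IdempotentQuotient.IsLeftGlued A →
      IdempotentQuotient.IsLeftGlued (IdempotentQuotient.quotByIdeal e)) ∧
    (IdempotentQuotient.IsWeaklyShod A →
      IdempotentQuotient.IsWeaklyShod (IdempotentQuotient.quotByIdeal e)) ∧
    (IdempotentQuotient.IsShod A →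
      IdempotentQuotient.IsShod (IdempotentQuotient.quotByIdeal e)) := by
  obtain ⟨hL, hR, hG, hW, hS⟩ := theorem4p1_general (RingCon.mk'_surjective _)
    (IdempotentQuotient.isIdempotentElem_ker_mk'_span he)
  exact ⟨hL, hR, hG, hW k, hS⟩
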